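/- Identify the unit circle $\mathbb{S}=\partial\mathbb{D}$ with $\mathbb{R}/\mathbb{Z}$, let $d\ge 2$, and let $\sigma_d(x)=dx$ on $\mathbb{S}$; $\sigma_d$ acts on (possibly degenerate) chords $\overline{ab}$ of $\mathbb{S}$ by $\sigma_d(\overline{ab})=\overline{\sigma_d(a)\sigma_d(b)}$. A *geolamination* is a collection $\mathcal{L}$ of (possibly degenerate) chords that are pairwise disjoint in the open disk $\mathbb{D}$, contains all points of $\mathbb{S}$, and has closed union. Its nondegenerate chords are called *leaves*. It is *$\sigma_d$-invariant* if (1) $\sigma_d(\ell)\in\mathcal{L}$ for each $\ell\in\mathcal{L}$; (2) each $\ell\in\mathcal{L}$ equals $\sigma_d(\ell')$ for some $\ell'\in\mathcal{L}$; (3) for each $\ell\in\mathcal{L}$ such that $\sigma_d(\ell)$ is a leaf, there are $d$ pairwise disjoint leaves in $\mathcal{L}$, one of which is $\ell$, all with the same image $\sigma_d(\ell)$. Two distinct chords are *linked* if they intersect in $\mathbb{D}$. A chord $\ell$ is *(pre)periodic* if $\sigma_d^{m+n}(\ell)=\sigma_d^m(\ell)$ for some $m\ge 0$ and $n\ge 1$.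 For chords $\ell,\ell'$ let the accordion $A_{\ell'}(\ell)$ consist of $\ell$ together with all chords $\sigma_d^k(\ell')$, $k\ge 0$, that are linked with $\ell$. The map $\sigma_d$ is *order preserving* on a set $X\subset\mathbb{S}$ if it is one-to-one on $X$ and preserves the positive circular order of every triple of distinct points of $X$. The chord $\ell$ *has order preserving accordions with respect to $\ell'$* if $A_{\ell'}(\ell)\ne\{\ell\}$ and, for each $k\ge 0$, $\sigma_d$ is order preserving on the set of endpoints of the chords in $A_{\ell'}(\sigma_d^k(\ell))$. The chords $\ell,\ell'$ *have mutually order preserving accordions* if each of them has order preserving accordions with respect to the other. Let $\mathcal{L}_1,\mathcal{L}_2$ be $\sigma_d$-invariant geolaminations, let $\ell_1$ be a leaf of $\mathcal{L}_1$, and let $\mathcal{B}$ be the collection of all leaves of $\mathcal{L}_2$ that are linked with $\ell_1$ and have mutually order preserving accordions with $\ell_1$. If $\ell_1$ is not (pre)periodic, then $\mathcal{B}$ is finite; if $\ell_1$ is (pre)periodic, then $\mathcal{B}$ is at most countable. -/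

import Mathlib

namespace Geolam

/-- The unit circle is `ℝ / ℤ`; `sigma d` is the `d`-tupling map `x ↦ d x`. -/
def sigma (d : ℕ) (x : UnitAddCircle) : UnitAddCircle := d • x

/-- A (possibly degenerate) chord of the unit disk, given by the unordered pair of its endpoints. -/
abbrev Chord := Sym2 UnitAddCircle

/-- The action of `sigma d` on chords: the chord with endpoints `x, y` goes to the chord with
endpoints `sigma d x, sigma d y`. -/
def chordMap (d : ℕ) : Chord → Chord := Sym2.map (sigma d)

/-- The point `exp (2 π i x)` of the complex plane that corresponds to `x ∈ ℝ / ℤ`. -/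
noncomputable def circlePt (x : UnitAddCircle) : ℂ := (AddCircle.toCircle x : ℂ)

/-- The chord as a closed straight segment in the closed unit disk. -/
def chordSet (l : Chord) : Set ℂ := convexHull ℝ (circlePt '' {x | x ∈ l})

/-- Two chords are linked (cross each other) if they are distinct and meet in the open disk. -/
def Linked (l m : Chord) : Prop :=
  l ≠ m ∧ (chordSet l ∩ chordSet m ∩ Metric.ball (0 : ℂ) 1).Nonempty

/-- A geolamination: a collection of chords, pairwise disjoint in the open disk, that contains all
points of the circle (as degenerate chords) and whose union is closed. -/
structure IsGeolamination (L : Set Chord) : Prop where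
  pairwise_disjoint : ∀ l ∈ L, ∀ m ∈ L, l ≠ m →
    Disjoint (chordSet l ∩ Metric.ball (0 : ℂ) 1) (chordSet m ∩ Metric.ball (0 : ℂ) 1)
  isClosed_union : IsClosed (⋃ l ∈ L, chordSet l)
  point_mem : ∀ x : UnitAddCircle, s(x, x) ∈ L

/-- A leaf of `L` is a nondegenerate chord of `L`. -/
def IsLeaf (L : Set Chord) (l : Chord) : Prop := l ∈ L ∧ ¬ l.IsDiag

/-- Sibling `sigma d`-invariant geolaminations. -/
structure IsInvariantGeolamination (d : ℕ) (L : Set Chord) : Prop extends IsGeolamination L where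
  map_mem : ∀ l ∈ L, chordMap d l ∈ L
  exists_pullback : ∀ l ∈ L, ∃ m ∈ L, chordMap d m = l
  exists_siblings : ∀ l ∈ L, ¬ (chordMap d l).IsDiag →
    ∃ f : Fin d → Chord, (∃ i, f i = l) ∧
      (∀ i, IsLeaf L (f i) ∧ chordMap d (f i) = chordMap d l) ∧
      ∀ i j, i ≠ j → Disjoint (chordSet (f i)) (chordSet (f j))

/-- A chord is (pre)periodic if one of its iterated images (possibly the chord itself)
is periodic. -/
def IsPreperiodicChord (d : ℕ) (l : Chord) : Prop :=
  ∃ m : ℕ, (chordMap d)^[m] l ∈ Function.periodicPts (chordMap d)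

/-- The accordion with axis `l₁` with respect to a leaf `l₂`: the axis together with all chords in
the forward orbit of `l₂` (which includes `l₂`) that are linked with `l₁`. -/
def accordion (d : ℕ) (l₂ l₁ : Chord) : Set Chord :=
  {m | m = l₁ ∨ ((∃ k : ℕ, m = (chordMap d)^[k] l₂) ∧ Linked m l₁)}

/-- The trace on the circle of the union of a collection of chords: the set of their endpoints. -/
def endpoints (A : Set Chord) : Set UnitAddCircle := {x | ∃ l ∈ A, x ∈ l}

/-- `sigma d` is order preserving on `X`: it is one-to-one on `X` and preserves the positive
circular order of triples of points of `X`. -/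
def OrderPreservingOn (d : ℕ) (X : Set UnitAddCircle) : Prop :=
  Set.InjOn (sigma d) X ∧
    ∀ x ∈ X, ∀ y ∈ X, ∀ z ∈ X, sbtw x y z → sbtw (sigma d x) (sigma d y) (sigma d z)

/-- `l₁` has order preserving accordions with respect to the leaf `l₂`. -/
def HasOrderPreservingAccordions (d : ℕ) (l₁ l₂ : Chord) : Prop :=
  accordion d l₂ l₁ ≠ {l₁} ∧
    ∀ k : ℕ, OrderPreservingOn d (endpoints (accordion d l₂ ((chordMap d)^[k] l₁)))

/-- `l₁` and `l₂` have mutually order preserving accordions. -/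
def MutuallyOrderPreservingAccordions (d : ℕ) (l₁ l₂ : Chord) : Prop :=
  HasOrderPreservingAccordions d l₁ l₂ ∧ HasOrderPreservingAccordions d l₂ l₁

/-- The collection of the leaves of `L₂` that are linked with `l₁` and have mutually order
preserving accordions with `l₁`. -/
def linkedMutualLeaves (d : ℕ) (L₂ : Set Chord) (l₁ : Chord) : Set Chord :=
  {l₂ | IsLeaf L₂ l₂ ∧ Linked l₂ l₁ ∧ MutuallyOrderPreservingAccordions d l₁ l₂}

end Geolam

/-!
Throughout, chords are written by their endpoints: the leaf `l₁` is `a b`, and a leaf of `L₂` that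
is linked with it and has mutually order preserving accordions with it is `x y`, labelled so that
`a, x, b, y` are in positive circular order (`AccordionPair`). Linked chords are exactly those whose
endpoints separate each other on the circle (`Linked.crossing`, `Crossing.linked`), and along a
mutually order preserving pair the iterates of `σ_d` preserve the circular order of all endpoints in
each accordion, so everything becomes a question about circular order and an expanding map.

The basic principle is that an orbit of an expanding circle map that moves monotonically along an
interval is eventually constant (`eventually_const_of_monotone`).

*The preperiodic case.* If some image of `a b` is fixed by an iterate of `σ_d`, that iterate moves
the endpoints of the corresponding image of `x y` monotonically within the two arcs cut out by the
fixed chord. So these endpoints are eventually fixed, `x` and `y` are preperiodic points, and there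
are only countably many of those (`AccordionPair.not_wandering`, `countable_setOf_not_wandering`).

*The other case.* Now neither `a b` nor any of the chords `x y` is preperiodic. The first claim is
that images of `a b` and of `x y` at different times never cross (`AccordionPair.not_crossing`). Two
different images of one chord cannot cross the same image of the other one in the same direction:
being unlinked they would be nested, the nesting would persist under iteration, and the chord would
be preperiodic (`Wandering.not_nested`). Hence a crossing at times `s < t` is in the direction
opposite to that of `a b` and `x y`, and iterating `σ_d ^ (t - s)` produces an infinite chain
of chords, taken alternately from the two orbits, each of which crosses only its two neighbours. The
chain turns around the circle in one direction; as chords that are not neighbours are unlinked, it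
cannot close up (`chain_bounded`), so its endpoints converge monotonically. That is again impossible
for an expanding map (`chain_false`).

Let `E t` be the set of endpoints of `σ_d ^ t (a b)` and of all chords `σ_d ^ t (x y)`. By the first
claim, for `s ≠ t` the set `E s` does not separate `E t` (`Unseparated`,
`unseparated_chordEnds`). Such a sequence of sets consists of finite sets
(`finite_of_unseparated`): by compactness, for every `ε` the set `E t` with `t` large has no three
points at mutual distance `ε` (`eventually_thin`). If `E 0`, and hence every `E t`, were infinite,
some `E t` would contain a huge `ε`-separated subset with `ε` small. Under `σ_d`, half of
such a subset survives (`exists_half_separated`), and some of it is lost only if two points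
about `j / d` apart nearly collide while a third point is close to one of them
(`nearCollision_or_exists_separated`). Near collisions come in boundedly many kinds, independently
of `ε`, and two of the same kind at different times would force one set to separate the other
(`NearCollision.false`). So the number of halvings, and with it the size of the subset, is bounded.
-/

namespace Geolam

/-! ### Arcs and circular order -/

/-- The length, in `[0, 1)`, of the positively oriented arc of the circle from `a` to `x`. -/
noncomputable def arc (a x : UnitAddCircle) : ℝ := (AddCircle.equivIco 1 0 (x - a) : ℝ)

lemma arc_nonneg (a x : UnitAddCircle) : 0 ≤ arc a x := (AddCircle.equivIco 1 0 (x - a)).2.1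

lemma arc_lt_one (a x : UnitAddCircle) : arc a x < 1 := by
  exact (AddCircle.equivIco (1 : ℝ) 0 (x - a)).2.2.trans_eq (zero_add 1)

lemma coe_arc (a x : UnitAddCircle) : ((arc a x : ℝ) : UnitAddCircle) = x - a :=
  AddCircle.coe_equivIco

lemma arc_eq_of_coe_eq {a x : UnitAddCircle} {t : ℝ} (h0 : 0 ≤ t) (h1 : t < 1)
    (h : (t : UnitAddCircle) = x - a) : arc a x = t := by
  unfold arc
  rw [← h]
  exact AddCircle.equivIco_coe_of_mem (p := (1 : ℝ)) (a := 0) ⟨h0, by simpa using h1⟩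

@[simp] lemma arc_self (a : UnitAddCircle) : arc a a = 0 :=
  arc_eq_of_coe_eq le_rfl one_pos (by simp)

lemma arc_left_inj {o p q : UnitAddCircle} : arc o p = arc o q ↔ p = q := by
  refine ⟨fun h => ?_, fun h => by rw [h]⟩
  have := coe_arc o p
  rw [h, coe_arc] at this
  exact (sub_left_inj.1 this).symm

lemma arc_eq_zero_iff {a x : UnitAddCircle} : arc a x = 0 ↔ x = a := by
  rw [← arc_self a, arc_left_inj]

lemma arc_pos_iff {a x : UnitAddCircle} : 0 < arc a x ↔ x ≠ a := by
  rw [(arc_nonneg a x).lt_iff_ne, ne_comm, Ne, arc_eq_zero_iff]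

/-- Change of base point: all arcs can be read off from the coordinates `arc o ·`. -/
lemma arc_rebase (o p q : UnitAddCircle) :
    arc p q = if arc o p ≤ arc o q then arc o q - arc o p else arc o q - arc o p + 1 := by
  have hp := arc_nonneg o p
  have hp' := arc_lt_one o p
  have hq := arc_nonneg o q
  have hq' := arc_lt_one o q
  split_ifs with h
  · refine arc_eq_of_coe_eq (by linarith) (by linarith) ?_
    rw [AddCircle.coe_sub, coe_arc, coe_arc]; abel
  · refine arc_eq_of_coe_eq (by linarith) (by linarith) ?_
    rw [AddCircle.coe_add, AddCircle.coe_sub, coe_arc, coe_arc, AddCircle.coe_period]; abel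

lemma arc_swap {a b : UnitAddCircle} (h : b ≠ a) : arc b a = 1 - arc a b := by
  have := arc_pos_iff.2 h
  rw [arc_rebase a b a, if_neg (by simpa using this)]
  simp; ring

lemma arc_neg {a b : UnitAddCircle} : arc (-a) (-b) = arc b a := by
  refine arc_eq_of_coe_eq (arc_nonneg _ _) (arc_lt_one _ _) ?_
  rw [coe_arc]; abel

lemma norm_sub_le_arc (a x : UnitAddCircle) : ‖x - a‖ ≤ arc a x := by
  rw [← coe_arc, UnitAddCircle.norm_eq]
  have := round_le (arc a x) 0
  simpa [abs_of_nonneg (arc_nonneg a x)] using this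

lemma norm_sub_le_one_sub_arc (a x : UnitAddCircle) : ‖x - a‖ ≤ 1 - arc a x := by
  rw [← coe_arc, UnitAddCircle.norm_eq]
  have := round_le (arc a x) 1
  rwa [abs_sub_comm (arc a x) ((1 : ℤ) : ℝ), Int.cast_one,
    abs_of_nonneg (by linarith [arc_lt_one a x] : 0 ≤ 1 - arc a x)] at this

lemma norm_sub_eq_min (a x : UnitAddCircle) : ‖x - a‖ = min (arc a x) (1 - arc a x) := by
  apply le_antisymm (le_min (norm_sub_le_arc a x) (norm_sub_le_one_sub_arc a x))
  rw [← coe_arc, UnitAddCircle.norm_eq, abs_sub_round_eq_min,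
    Int.fract_eq_self.2 ⟨arc_nonneg a x, arc_lt_one a x⟩]

lemma sbtw_iff_arc {a b c : UnitAddCircle} : sbtw a b c ↔ 0 < arc a b ∧ arc a b < arc a c := by
  have key : sbtw a b c ↔ a ≠ c ∧ arc c a < arc c b := by
    rw [sbtw_iff_not_btw]
    have hb : btw c b a ↔ arc c b ≤ (AddCircle.equivIoc 1 0 (a - c) : ℝ) := Iff.rfl
    rw [hb, not_le]
    by_cases hac : a = c
    · subst hac
      have : (AddCircle.equivIoc (1 : ℝ) 0 (a - a) : ℝ) = 1 := by
        have h := (AddCircle.equivIoc (1 : ℝ) 0).right_inv ⟨1, by simp⟩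
        have h' : AddCircle.equivIoc (1 : ℝ) 0 ((1 : ℝ) : UnitAddCircle) = ⟨1, by simp⟩ := h
        rw [AddCircle.coe_period] at h'
        rw [sub_self, h']
      rw [this]
      simp [(arc_lt_one a b).le]
    · have : (AddCircle.equivIoc (1 : ℝ) 0 (a - c) : ℝ) = arc c a := by
        have h := (AddCircle.equivIoc (1 : ℝ) 0).right_inv
          ⟨arc c a, arc_pos_iff.2 hac, by simpa using (arc_lt_one c a).le⟩
        have h' : AddCircle.equivIoc (1 : ℝ) 0 ((arc c a : ℝ) : UnitAddCircle) = ⟨arc c a, _⟩ := h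
        rw [coe_arc] at h'
        rw [h']
      rw [this]
      simp [hac]
  rw [key]
  constructor
  · rintro ⟨h1, h2⟩
    have h3 := arc_pos_iff.2 h1
    have h4 := arc_lt_one c b
    rw [arc_rebase c a b, arc_rebase c a c, arc_self, if_pos h2.le, if_neg (by linarith)]
    constructor <;> linarith
  · rintro ⟨h1, h2⟩
    have h3 : c ≠ a := by rintro rfl; simp at h2; linarith
    refine ⟨h3.symm, ?_⟩
    have h4 := arc_lt_one a c
    have h5 := arc_lt_one a b
    rw [arc_rebase a c a, arc_rebase a c b, arc_self, if_neg (by linarith), if_neg (by linarith)]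
    linarith

/-- `g` preserves the circular order of the points of `S`, expressed by comparing arcs with a common
initial point. This includes injectivity on `S`. -/
def ArcMono (g : UnitAddCircle → UnitAddCircle) (S : Set UnitAddCircle) : Prop :=
  ∀ a ∈ S, ∀ b ∈ S, ∀ c ∈ S, arc a b < arc a c ↔ arc (g a) (g b) < arc (g a) (g c)

lemma OrderPreservingOn.arcMono {d : ℕ} {S : Set UnitAddCircle} (h : OrderPreservingOn d S) :
    ArcMono (sigma d) S := by
  have fwd : ∀ a ∈ S, ∀ b ∈ S, ∀ c ∈ S, arc a b < arc a c →
      arc (sigma d a) (sigma d b) < arc (sigma d a) (sigma d c) := by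
    intro a ha b hb c hc hlt
    by_cases hab : b = a
    · subst hab
      rw [arc_self] at hlt
      rw [arc_self, arc_pos_iff]
      intro he
      rw [h.1 hc hb he, arc_self] at hlt
      exact lt_irrefl _ hlt
    · exact (sbtw_iff_arc.1 (h.2 a ha b hb c hc (sbtw_iff_arc.2 ⟨arc_pos_iff.2 hab, hlt⟩))).2
  intro a ha b hb c hc
  refine ⟨fwd a ha b hb c hc, fun hlt => ?_⟩
  by_contra hcon
  rcases (not_lt.1 hcon).lt_or_eq with h1 | h1
  · exact lt_asymm hlt (fwd a ha c hc b hb h1)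
  · rw [arc_left_inj.1 h1] at hlt
    exact lt_irrefl _ hlt

lemma ArcMono.mono {g : UnitAddCircle → UnitAddCircle} {S T : Set UnitAddCircle}
    (h : ArcMono g T) (hST : S ⊆ T) : ArcMono g S :=
  fun a ha b hb c hc => h a (hST ha) b (hST hb) c (hST hc)

lemma ArcMono.comp {f g : UnitAddCircle → UnitAddCircle} {S T : Set UnitAddCircle}
    (hf : ArcMono f T) (hg : ArcMono g S) (hST : Set.MapsTo g S T) : ArcMono (f ∘ g) S :=
  fun a ha b hb c hc =>
    (hg a ha b hb c hc).trans (hf _ (hST ha) _ (hST hb) _ (hST hc))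

lemma ArcMono.le_iff {g : UnitAddCircle → UnitAddCircle} {S : Set UnitAddCircle}
    (h : ArcMono g S) {a b c : UnitAddCircle} (ha : a ∈ S) (hb : b ∈ S) (hc : c ∈ S) :
    arc a b ≤ arc a c ↔ arc (g a) (g b) ≤ arc (g a) (g c) := by
  rw [← not_lt, ← not_lt, h a ha c hc b hb]

lemma ArcMono.pos_iff {g : UnitAddCircle → UnitAddCircle} {S : Set UnitAddCircle}
    (h : ArcMono g S) {a b : UnitAddCircle} (ha : a ∈ S) (hb : b ∈ S) :
    0 < arc a b ↔ 0 < arc (g a) (g b) := by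
  simpa using h a ha a ha b hb

/-- The points `p, q, r, s` are distinct and follow each other in this positive circular order. -/
def Cyc4 (p q r s : UnitAddCircle) : Prop :=
  0 < arc p q ∧ arc p q < arc p r ∧ arc p r < arc p s

lemma Cyc4.rotate {p q r s : UnitAddCircle} (h : Cyc4 p q r s) : Cyc4 q r s p := by
  obtain ⟨h1, h2, h3⟩ := h
  have h4 := arc_lt_one p s
  refine ⟨?_, ?_, ?_⟩ <;>
  · simp only [arc_rebase p q, arc_self]
    repeat rw [if_pos (by linarith)]
    try rw [if_neg (by linarith)]
    linarith

lemma Cyc4.ne {p q r s : UnitAddCircle} (h : Cyc4 p q r s) : p ≠ r := by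
  rintro rfl
  have := h.2.1
  rw [arc_self] at this
  linarith [h.1]

/-- The chords with endpoints `a, b` and `x, y` cross, in terms of the circular order of their
endpoints. -/
def Crossing (a b x y : UnitAddCircle) : Prop := Cyc4 a x b y ∨ Cyc4 a y b x

lemma Crossing.symm {a b x y : UnitAddCircle} (h : Crossing a b x y) : Crossing x y a b :=
  h.elim (fun h => Or.inr h.rotate) fun h => Or.inl h.rotate.rotate.rotate

lemma Crossing.swap_right {a b x y : UnitAddCircle} (h : Crossing a b x y) : Crossing a b y x :=
  Or.symm h

lemma Crossing.swap_left {a b x y : UnitAddCircle} (h : Crossing a b x y) : Crossing b a x y :=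
  h.symm.swap_right.symm

lemma ArcMono.cyc4_iff {g : UnitAddCircle → UnitAddCircle} {S : Set UnitAddCircle}
    (h : ArcMono g S) {p q r s : UnitAddCircle} (hp : p ∈ S) (hq : q ∈ S) (hr : r ∈ S)
    (hs : s ∈ S) : Cyc4 p q r s ↔ Cyc4 (g p) (g q) (g r) (g s) :=
  and_congr (h.pos_iff hp hq) (and_congr (h p hp q hq r hr) (h p hp r hr s hs))

/-! ### Crossing chords in the disk -/

lemma chordSet_mk (a b : UnitAddCircle) :
    chordSet s(a, b) = segment ℝ (circlePt a) (circlePt b) := by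
  have : {x | x ∈ s(a, b)} = {a, b} := by ext; simp
  rw [chordSet, this, Set.image_pair, convexHull_pair]

lemma circlePt_re_sq_add_im_sq (a : UnitAddCircle) :
    (circlePt a).re ^ 2 + (circlePt a).im ^ 2 = 1 := by
  have : Complex.normSq (circlePt a) = 1 := Circle.normSq_coe _
  rw [Complex.normSq_apply] at this
  linarith

lemma circlePt_eq_mul (a b : UnitAddCircle) :
    circlePt b = circlePt a *
      (Real.cos (2 * (Real.pi * arc a b)) + Real.sin (2 * (Real.pi * arc a b)) * Complex.I) := by
  have h : b = a + ((arc a b : ℝ) : UnitAddCircle) := by rw [coe_arc]; abel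
  conv_lhs => rw [h]
  rw [circlePt, AddCircle.toCircle_add, Circle.coe_mul, AddCircle.toCircle_apply_mk,
    Circle.coe_exp, Complex.exp_mul_I, ← Complex.ofReal_cos, ← Complex.ofReal_sin, circlePt,
    div_one, mul_assoc]

/-- Twice the signed area of the triangle with vertices `p, q, r`. -/
def signedArea (p q r : ℂ) : ℝ :=
  (q.re - p.re) * (r.im - p.im) - (q.im - p.im) * (r.re - p.re)

lemma signedArea_circlePt (a b x : UnitAddCircle) :
    signedArea (circlePt a) (circlePt b) (circlePt x) =
      4 * Real.sin (Real.pi * arc a b) * Real.sin (Real.pi * arc a x) *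
        Real.sin (Real.pi * arc a x - Real.pi * arc a b) := by
  rw [circlePt_eq_mul a b, circlePt_eq_mul a x, signedArea, Real.sin_sub]
  have h1 := circlePt_re_sq_add_im_sq a
  have h2 := Real.sin_sq_add_cos_sq (Real.pi * arc a b)
  have h3 := Real.sin_sq_add_cos_sq (Real.pi * arc a x)
  simp only [Complex.mul_re, Complex.mul_im, Complex.add_re, Complex.add_im, Complex.ofReal_re,
    Complex.ofReal_im, Complex.I_re, Complex.I_im, Real.cos_two_mul, Real.sin_two_mul]
  set c := (circlePt a).re
  set s := (circlePt a).im
  set cb := Real.cos (Real.pi * arc a b)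
  set sb := Real.sin (Real.pi * arc a b)
  set cx := Real.cos (Real.pi * arc a x)
  set sx := Real.sin (Real.pi * arc a x)
  have h2' : cb ^ 2 = 1 - sb ^ 2 := by linarith
  have h3' : cx ^ 2 = 1 - sx ^ 2 := by linarith
  rw [h2', h3']
  linear_combination (4 * sb * sx * (sx * cb - cx * sb)) * h1

lemma sin_pi_mul_arc_pos {a b : UnitAddCircle} (h : 0 < arc a b) :
    0 < Real.sin (Real.pi * arc a b) :=
  Real.sin_pos_of_pos_of_lt_pi (mul_pos Real.pi_pos h)
    (by nlinarith [Real.pi_pos, arc_lt_one a b])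

lemma sin_pi_mul_arc_sub_pos {a b x : UnitAddCircle} (h : arc a b < arc a x) :
    0 < Real.sin (Real.pi * arc a x - Real.pi * arc a b) :=
  Real.sin_pos_of_pos_of_lt_pi (by nlinarith [Real.pi_pos])
    (by nlinarith [Real.pi_pos, arc_lt_one a x, arc_nonneg a b])

lemma signedArea_circlePt_pos {a b x : UnitAddCircle} (h0 : 0 < arc a b)
    (h : arc a b < arc a x) : 0 < signedArea (circlePt a) (circlePt b) (circlePt x) := by
  rw [signedArea_circlePt]
  have h1 := sin_pi_mul_arc_pos h0
  have h2 := sin_pi_mul_arc_pos (h0.trans h)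
  have h3 := sin_pi_mul_arc_sub_pos h
  positivity

lemma signedArea_swap_right (p q r : ℂ) : signedArea p r q = -signedArea p q r := by
  unfold signedArea; ring

lemma signedArea_circlePt_neg {a b x : UnitAddCircle} (h0 : 0 < arc a x)
    (h : arc a x < arc a b) : signedArea (circlePt a) (circlePt b) (circlePt x) < 0 := by
  have := signedArea_circlePt_pos h0 h
  rw [signedArea_swap_right]
  linarith

lemma circlePt_injective : Function.Injective circlePt := fun _ _ h =>
  AddCircle.injective_toCircle one_ne_zero (Subtype.ext h)

lemma norm_circlePt (a : UnitAddCircle) : ‖circlePt a‖ = 1 := Circle.norm_coe _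

/-- A proper convex combination of two distinct points of the unit circle lies in the open disk. -/
lemma norm_combo_lt_one {a b : UnitAddCircle} (hab : a ≠ b) {s t : ℝ} (hs : 0 < s) (ht : 0 < t)
    (hst : s + t = 1) : ‖s • circlePt a + t • circlePt b‖ < 1 :=
  norm_combo_lt_of_ne (norm_circlePt a).le (norm_circlePt b).le
    (fun h => hab (circlePt_injective h)) hs ht hst

lemma linked_of_cyc4 {a x b y : UnitAddCircle} (h : Cyc4 a x b y) : Linked s(a, b) s(x, y) := by
  have hab : a ≠ b := h.ne
  have hax : x ≠ a := arc_pos_iff.1 h.1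
  have hay : y ≠ a := arc_pos_iff.1 (h.1.trans (h.2.1.trans h.2.2))
  refine ⟨?_, ?_⟩
  · intro he
    have : a ∈ s(x, y) := he ▸ Sym2.mem_mk_left a b
    rcases Sym2.mem_iff.1 this with h1 | h1
    · exact hax h1.symm
    · exact hay h1.symm
  -- The four points satisfy an affine dependency whose coefficients are signed areas.
  have hb := h.rotate.rotate
  set A := circlePt a
  set B := circlePt b
  set X := circlePt x
  set Y := circlePt y
  have w1 : 0 < -signedArea B X Y := by
    have := signedArea_circlePt_neg (a := b) (b := x) (x := y) hb.1 (hb.2.1.trans hb.2.2)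
    simpa using this
  have w2 : 0 < signedArea A X Y := signedArea_circlePt_pos h.1 (h.2.1.trans h.2.2)
  have w3 : 0 < signedArea A B Y := signedArea_circlePt_pos (h.1.trans h.2.1) h.2.2
  have w4 : 0 < -signedArea A B X := by
    have := signedArea_circlePt_neg (a := a) (b := b) (x := x) h.1 h.2.1
    simpa using this
  set W := -signedArea B X Y + signedArea A X Y with hW
  have hWpos : 0 < W := by linarith
  have hW' : W = signedArea A B Y + -signedArea A B X := by
    rw [hW]; unfold signedArea; ring
  have e1 : -signedArea B X Y / W + signedArea A X Y / W = 1 := by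
    rw [← add_div, div_self hWpos.ne']
  have e2 : signedArea A B Y / W + -signedArea A B X / W = 1 := by
    rw [← add_div, ← hW', div_self hWpos.ne']
  have key : (-signedArea B X Y / W) • A + (signedArea A X Y / W) • B =
      (signedArea A B Y / W) • X + (-signedArea A B X / W) • Y := by
    have : (-signedArea B X Y) • A + (signedArea A X Y) • B =
      (signedArea A B Y) • X + (-signedArea A B X) • Y := by
      unfold signedArea
      apply Complex.ext <;> simp <;> ring
    simp only [div_eq_inv_mul, mul_smul, ← smul_add, this]
  refine ⟨(-signedArea B X Y / W) • A + (signedArea A X Y / W) • B, ⟨?_, ?_⟩, ?_⟩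
  · rw [chordSet_mk]
    exact ⟨_, _, by positivity, by positivity, e1, rfl⟩
  · rw [key, chordSet_mk]
    exact ⟨_, _, by positivity, by positivity, e2, rfl⟩
  · rw [mem_ball_zero_iff]
    exact norm_combo_lt_one hab (by positivity) (by positivity) e1

lemma Crossing.linked {a b x y : UnitAddCircle} (h : Crossing a b x y) :
    Linked s(a, b) s(x, y) := by
  rcases h with h | h
  · exact linked_of_cyc4 h
  · rw [Sym2.eq_swap (a := x)]
    exact linked_of_cyc4 h

lemma signedArea_combo_right (p q r s : ℂ) {u v : ℝ} (h : u + v = 1) :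
    signedArea p q (u • r + v • s) = u * signedArea p q r + v * signedArea p q s := by
  obtain rfl : v = 1 - u := by linarith
  simp only [signedArea, Complex.add_re, Complex.add_im, Complex.real_smul, Complex.re_ofReal_mul,
    Complex.im_ofReal_mul]
  ring

lemma arc_eq_of_signedArea_eq_zero {a b x : UnitAddCircle} (hab : a ≠ b)
    (h : signedArea (circlePt a) (circlePt b) (circlePt x) = 0) : x = a ∨ x = b := by
  by_contra! hcon
  have hx := arc_pos_iff.2 hcon.1
  have hb := arc_pos_iff.2 hab.symm
  rcases lt_trichotomy (arc a b) (arc a x) with h1 | h1 | h1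
  · exact (signedArea_circlePt_pos hb h1).ne' h
  · exact hcon.2 (arc_left_inj.1 h1).symm
  · exact (signedArea_circlePt_neg hx h1).ne h

/-- Two distinct nondegenerate chords that meet in the open disk have alternating endpoints:
otherwise one of them lies in a closed half-plane bounded by the other. -/
lemma Linked.crossing {a b x y : UnitAddCircle} (hab : a ≠ b) (hxy : x ≠ y)
    (h : Linked s(a, b) s(x, y)) : Crossing a b x y := by
  obtain ⟨hne, z, ⟨hz1, hz2⟩, hz3⟩ := h
  rw [chordSet_mk] at hz1 hz2
  obtain ⟨s, t, hs, ht, hst, rfl⟩ := hz1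
  obtain ⟨u, v, hu, hv, huv, hz⟩ := hz2
  have hz0 : signedArea (circlePt a) (circlePt b) (s • circlePt a + t • circlePt b) = 0 := by
    rw [signedArea_combo_right _ _ _ _ hst]
    unfold signedArea; ring
  rw [← hz, signedArea_combo_right _ _ _ _ huv] at hz0
  rw [← hz, mem_ball_zero_iff] at hz3
  have hu' : 0 < u := by
    refine hu.lt_of_ne ?_
    rintro rfl
    obtain rfl : v = 1 := by linarith
    simp [norm_circlePt] at hz3
  have hv' : 0 < v := by
    refine hv.lt_of_ne ?_
    rintro rfl
    obtain rfl : u = 1 := by linarith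
    simp [norm_circlePt] at hz3
  have hb := arc_pos_iff.2 hab.symm
  -- A point strictly between `a` and `b` lies on the negative side of the line.
  have sideneg : ∀ p, signedArea (circlePt a) (circlePt b) (circlePt p) < 0 →
      0 < arc a p ∧ arc a p < arc a b := by
    intro p hp
    by_contra! hcon
    by_cases hpa : p = a
    · subst hpa; unfold signedArea at hp; linarith
    · rcases (hcon (arc_pos_iff.2 hpa)).lt_or_eq with h1 | h1
      · exact lt_asymm hp (signedArea_circlePt_pos hb h1)
      · rw [arc_left_inj.1 h1] at hp; unfold signedArea at hp; linarith
  have sidepos : ∀ p, 0 < signedArea (circlePt a) (circlePt b) (circlePt p) →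
      arc a b < arc a p := by
    intro p hp
    by_contra! hcon
    by_cases hpa : p = a
    · subst hpa; unfold signedArea at hp; linarith
    · rcases hcon.lt_or_eq with h1 | h1
      · exact lt_asymm hp (signedArea_circlePt_neg (arc_pos_iff.2 hpa) h1)
      · rw [arc_left_inj.1 h1] at hp; unfold signedArea at hp; linarith
  rcases lt_trichotomy (signedArea (circlePt a) (circlePt b) (circlePt x)) 0 with h1 | h1 | h1
  · have h2 : 0 < signedArea (circlePt a) (circlePt b) (circlePt y) := by
      by_contra! h2
      nlinarith [mul_neg_of_pos_of_neg hu' h1, mul_nonneg hv'.le (neg_nonneg.2 h2)]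
    have := sideneg x h1
    exact Or.inl ⟨this.1, this.2, sidepos y h2⟩
  · have h2 : signedArea (circlePt a) (circlePt b) (circlePt y) = 0 := by
      rw [h1, mul_zero, zero_add] at hz0
      exact (mul_eq_zero.1 hz0).resolve_left hv'.ne'
    exfalso
    rcases arc_eq_of_signedArea_eq_zero hab h1 with rfl | rfl <;>
    rcases arc_eq_of_signedArea_eq_zero hab h2 with rfl | rfl
    · exact hxy rfl
    · exact hne rfl
    · exact hne Sym2.eq_swap
    · exact hxy rfl
  · have h2 : signedArea (circlePt a) (circlePt b) (circlePt y) < 0 := by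
      by_contra! h2
      nlinarith [mul_pos hu' h1, mul_nonneg hv'.le h2]
    have := sideneg y h2
    exact Or.inr ⟨this.1, this.2, sidepos x h1⟩

/-! ### Monotone orbits of expanding maps -/

open Filter Topology in
/-- A bounded monotone sequence that is, modulo `1`, an orbit of the expanding map `x ↦ D x`
is eventually constant: its increments tend to `0`, hence are eventually multiplied by exactly
`D`. -/
lemma eventually_const_of_monotone {z : ℕ → ℝ} {D : ℕ} (hD : 2 ≤ D) (hmono : Monotone z)
    {C : ℝ} (hC : ∀ i, z i ≤ C)
    (hz : ∀ i, ((D * z i : ℝ) : UnitAddCircle) = (z (i + 1) : ℝ)) :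
    ∃ N, ∀ i, N ≤ i → z (i + 1) = z i := by
  have hlim : Tendsto z atTop (𝓝 (⨆ i, z i)) :=
    tendsto_atTop_ciSup hmono ⟨C, by rintro _ ⟨i, rfl⟩; exact hC i⟩
  have hdiff : Tendsto (fun i => z (i + 1) - z i) atTop (𝓝 0) := by
    simpa using ((tendsto_add_atTop_iff_nat 1).2 hlim).sub hlim
  have hD' : (2 : ℝ) ≤ D := by exact_mod_cast hD
  obtain ⟨N, hN⟩ := eventually_atTop.1
    (hdiff.eventually (gt_mem_nhds (show (0 : ℝ) < 1 / (2 * D) by positivity)))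
  have hnn : ∀ i, 0 ≤ z (i + 1) - z i := fun i => sub_nonneg.2 (hmono (Nat.le_succ i))
  have hstep : ∀ i, N ≤ i → z (i + 2) - z (i + 1) = D * (z (i + 1) - z i) := by
    intro i hi
    have h1 : ((D * (z (i + 1) - z i) - (z (i + 2) - z (i + 1)) : ℝ) : UnitAddCircle) = 0 := by
      have : (D * (z (i + 1) - z i) - (z (i + 2) - z (i + 1)) : ℝ) =
        (D * z (i + 1) - z (i + 1 + 1)) - (D * z i - z (i + 1)) := by ring
      rw [this, AddCircle.coe_sub, AddCircle.coe_sub, AddCircle.coe_sub, hz, hz]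
      simp
    obtain ⟨n, hn⟩ := (AddCircle.coe_eq_zero_iff (1 : ℝ)).1 h1
    simp only [zsmul_eq_mul, mul_one] at hn
    have h2 := hN i hi
    have h3 := hN (i + 1) (by omega)
    have h4 : (D : ℝ) * (z (i + 1) - z i) < 1 / 2 := by
      have := mul_lt_mul_of_pos_left h2 (show (0 : ℝ) < D by linarith)
      have e : (D : ℝ) * (1 / (2 * D)) = 1 / 2 := by field_simp
      linarith
    have h5 : (1 : ℝ) / (2 * D) ≤ 1 / 4 := by
      apply one_div_le_one_div_of_le <;> linarith
    have h6 : z (i + 2) - z (i + 1) < 1 / 4 := h3.trans_le h5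
    have h7 := hnn i
    have h8 : 0 ≤ z (i + 2) - z (i + 1) := hnn (i + 1)
    have h9 : 0 ≤ (D : ℝ) * (z (i + 1) - z i) := by positivity
    have h10 : (n : ℝ) < 1 := by linarith
    have h11 : (-1 : ℝ) < n := by linarith
    have h12 : n = 0 := by
      have : n < 1 := by exact_mod_cast h10
      have : -1 < n := by exact_mod_cast h11
      omega
    subst h12
    push_cast at hn
    linarith
  refine ⟨N, fun i hi => ?_⟩
  by_contra hne
  have hpos : 0 < z (i + 1) - z i := (hnn i).lt_of_ne fun h => hne (by linarith)
  have hgrow : ∀ k, z (i + 1) - z i ≤ z (i + k + 1) - z (i + k) := by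
    intro k
    induction k with
    | zero => simp
    | succ k ih =>
      have := hstep (i + k) (by omega)
      have e : z (i + (k + 1) + 1) - z (i + (k + 1)) = z (i + k + 2) - z (i + k + 1) := rfl
      rw [e, this]
      nlinarith [hnn (i + k)]
  have : Tendsto (fun k => z (i + k + 1) - z (i + k)) atTop (𝓝 0) := by
    have := (tendsto_add_atTop_iff_nat i).2 hdiff
    simpa [add_comm, add_left_comm] using this
  exact absurd (ge_of_tendsto' this hgrow) (not_le.2 hpos)

lemma eventually_const_of_antitone {z : ℕ → ℝ} {D : ℕ} (hD : 2 ≤ D) (hanti : Antitone z)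
    {C : ℝ} (hC : ∀ i, C ≤ z i)
    (hz : ∀ i, ((D * z i : ℝ) : UnitAddCircle) = (z (i + 1) : ℝ)) :
    ∃ N, ∀ i, N ≤ i → z (i + 1) = z i := by
  obtain ⟨N, hN⟩ := eventually_const_of_monotone (z := fun i => -z i) hD hanti.neg
    (C := -C) (fun i => neg_le_neg (hC i))
    (fun i => by rw [mul_neg, AddCircle.coe_neg, hz, AddCircle.coe_neg])
  exact ⟨N, fun i hi => neg_injective (hN i hi)⟩

/-- Partial sums of consecutive arcs lift a sequence on the circle to the real line. -/
noncomputable def arcLift (u : ℕ → UnitAddCircle) (i : ℕ) : ℝ :=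
  arc 0 (u 0) + ∑ j ∈ Finset.range i, arc (u j) (u (j + 1))

lemma arcLift_succ (u : ℕ → UnitAddCircle) (i : ℕ) :
    arcLift u (i + 1) = arcLift u i + arc (u i) (u (i + 1)) := by
  rw [arcLift, Finset.sum_range_succ, arcLift]; ring

lemma coe_arcLift (u : ℕ → UnitAddCircle) (i : ℕ) : ((arcLift u i : ℝ) : UnitAddCircle) = u i := by
  induction i with
  | zero => simp [arcLift, coe_arc]
  | succ i ih => rw [arcLift_succ, AddCircle.coe_add, ih, coe_arc]; abel

lemma arcLift_monotone (u : ℕ → UnitAddCircle) : Monotone (arcLift u) :=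
  monotone_nat_of_le_succ fun i => by
    rw [arcLift_succ]; linarith [arc_nonneg (u i) (u (i + 1))]

/-- If the lifted orbit of a point under `x ↦ D x` is bounded, the orbit is eventually fixed. -/
lemma eventually_fixed_of_arcLift_le {u : ℕ → UnitAddCircle} {D : ℕ} (hD : 2 ≤ D)
    (hu : ∀ i, u (i + 1) = D • u i) {C : ℝ} (hC : ∀ i, arcLift u i ≤ C) :
    ∃ N, ∀ i, N ≤ i → u (i + 1) = u i := by
  obtain ⟨N, hN⟩ := eventually_const_of_monotone hD (arcLift_monotone u) hC (fun i => by
    rw [coe_arcLift, hu, ← nsmul_eq_mul, AddCircle.coe_nsmul, coe_arcLift])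
  exact ⟨N, fun i hi => by rw [← coe_arcLift u, hN i hi, coe_arcLift]⟩

/-- A monotonically nested orbit of chords under `x ↦ D x` is eventually fixed. -/
lemma eventually_fixed_of_nested {u v : ℕ → UnitAddCircle} {D : ℕ} (hD : 2 ≤ D)
    (hu : ∀ i, u (i + 1) = D • u i) (hv : ∀ i, v (i + 1) = D • v i)
    (h : ∀ i, arc (u i) (u (i + 1)) < arc (u i) (v (i + 1)) ∧
      arc (u i) (v (i + 1)) ≤ arc (u i) (v i)) :
    ∃ i, u (i + 1) = u i ∧ v (i + 1) = v i := by
  have hb : ∀ i, arcLift u i + arc (u i) (v i) ≤ arcLift u 0 + 1 := by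
    intro i
    induction i with
    | zero => linarith [arc_lt_one (u 0) (v 0)]
    | succ i ih =>
      have h1 := (h i).1
      have h2 := (h i).2
      rw [arcLift_succ, arc_rebase (u i) (u (i + 1)) (v (i + 1)), if_pos h1.le]
      linarith
  obtain ⟨N, hN⟩ := eventually_fixed_of_arcLift_le hD hu (C := arcLift u 0 + 1)
    (fun i => by linarith [hb i, arc_nonneg (u i) (v i)])
  have hconst : ∀ i, u (N + i) = u N := by
    intro i
    induction i with
    | zero => rfl
    | succ i ih => rw [← ih]; exact hN (N + i) (by omega)
  have hDu : D • u N = u N := by rw [← hu, hN N le_rfl]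
  obtain ⟨M, hM⟩ := eventually_const_of_antitone (z := fun i => arc (u N) (v (N + i))) hD
    (antitone_nat_of_succ_le fun i => by
      have := (h (N + i)).2
      rw [hconst] at this
      exact this) (C := 0) (fun i => arc_nonneg _ _) (fun i => by
        rw [← nsmul_eq_mul, AddCircle.coe_nsmul, coe_arc, coe_arc, smul_sub, hDu, ← hv]; rfl)
  exact ⟨N + M, hN _ (by omega), arc_left_inj.1 (hM M le_rfl)⟩

/-- Intervals `(l j, r j)` on the line, each overlapping only the next one on the right, such that
consecutive ones at distance two do not meet modulo `1`. If intervals at distance at least two are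
unlinked modulo `1`, then the chain never closes up: it cannot leave `(l 0, l 0 + 1]`. Indeed, the
first interval to do so would have to jump over the translates of all previous intervals. -/
lemma chain_bounded {l r : ℕ → ℝ} (h1 : ∀ j, l j < l (j + 1)) (h2 : ∀ j, l (j + 1) < r j)
    (h3 : ∀ j, r j ≤ l (j + 2)) (h4 : ∀ j, r (j + 2) ≤ l j + 1)
    (hun : ∀ m k, m + 2 ≤ k → l k < l m + 1 → l m + 1 < r k → r m + 1 ≤ r k) (k : ℕ) :
    r k ≤ l 0 + 1 := by
  have hl : StrictMono l := strictMono_nat_of_lt_succ h1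
  induction k using Nat.strong_induction_on with
  | _ k ih =>
    by_contra! hk
    match k, ih, hk with
    | 0, _, hk => linarith [h2 1, h3 0, h4 0, h1 2, h2 2]
    | 1, _, hk => linarith [h3 1, h2 2, h1 3, h2 3, h4 0, h1 2]
    | 2, _, hk => linarith [h4 0]
    | k + 3, ih, hk =>
      have hprev := ih (k + 2) (by omega)
      have hjump : ∀ m, m ≤ k + 1 → r m + 1 ≤ r (k + 3) := by
        intro m
        induction m with
        | zero => intro _; exact hun 0 (k + 3) (by omega) (by linarith [h2 (k + 2)]) hk
        | succ m ihm =>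
          intro hm
          have := ihm (by omega)
          refine hun (m + 1) (k + 3) (by omega) ?_ (by linarith [h2 m])
          linarith [h2 (k + 2), hl (Nat.succ_pos m)]
      linarith [hjump (k + 1) le_rfl, h4 (k + 1), h1 (k + 1), h2 (k + 1)]

/-! ### Sets that do not separate each other -/

/-- `E'` is not separated by `E`: for any three points of `E`, one of the three closed arcs they cut
out of the circle contains all of `E'`. -/
def Unseparated (E E' : Set UnitAddCircle) : Prop :=
  ∀ p ∈ E, ∀ q ∈ E, ∀ r ∈ E, 0 < arc p q → arc p q < arc p r →
    (∀ e ∈ E', arc p e ≤ arc p q) ∨ (∀ e ∈ E', arc p q ≤ arc p e ∧ arc p e ≤ arc p r) ∨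
      (∀ e ∈ E', e = p ∨ arc p r ≤ arc p e)

/-- Three points of `E` at mutual distance at least `η` and three points of `E'` close to them
cannot coexist if `E` does not separate `E'`. -/
lemma Unseparated.not_close {E E' : Set UnitAddCircle} (h : Unseparated E E') {η : ℝ}
    {p q r p' q' r' : UnitAddCircle} (hp : p ∈ E) (hq : q ∈ E) (hr : r ∈ E) (hp' : p' ∈ E')
    (hq' : q' ∈ E') (hr' : r' ∈ E') (hpq : η ≤ ‖q - p‖) (hqr : η ≤ ‖r - q‖) (hpr : η ≤ ‖r - p‖)
    (hpp : ‖p' - p‖ < η) (hqq : ‖q' - q‖ < η) (hrr : ‖r' - r‖ < η) : False := by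
  have hη : 0 < η := (norm_nonneg _).trans_lt hpp
  wlog hlt : arc p q < arc p r generalizing q r q' r'
  · refine this hr hq hr' hq' hpr (by rwa [norm_sub_rev]) hpq hrr hqq ?_
    refine (not_lt.1 hlt).lt_of_ne fun he => ?_
    rw [arc_left_inj.1 he, sub_self, norm_zero] at hqr
    linarith
  rw [norm_sub_eq_min] at hpq hqr hpr hpp hqq hrr
  rw [arc_rebase p q r, if_pos hlt.le] at hqr
  have key : ∀ x x' : UnitAddCircle, min (arc x x') (1 - arc x x') < η →
      (|arc p x' - arc p x| < η) ∨ (1 - η < |arc p x' - arc p x|) := by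
    intro x x' hx
    rw [arc_rebase p x x'] at hx
    rcases min_lt_iff.1 hx with h1 | h1 <;> split_ifs at h1 with h2
    · left; rw [abs_lt]; constructor <;> linarith
    · right; rw [abs_of_nonpos (by linarith)]; linarith
    · right; rw [abs_of_nonneg (by linarith)]; linarith
    · left; rw [abs_lt]; constructor <;> linarith
  have kp : arc p p' < η ∨ 1 - η < arc p p' := by
    rcases min_lt_iff.1 hpp with h1 | h1
    · exact Or.inl h1
    · right; linarith
  have kq := key q q' hqq
  have kr := key r r' hrr
  rw [le_min_iff] at hpq hqr hpr
  have hp1 := arc_nonneg p p'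
  have hq1 := arc_nonneg p q'
  have hr1 := arc_nonneg p r'
  have hp2 := arc_lt_one p p'
  have hq2 := arc_lt_one p q'
  have hr2 := arc_lt_one p r'
  simp only [abs_lt, lt_abs] at kq kr
  rcases h p hp q hq r hr (by linarith) hlt with h1 | h1 | h1
  · have := h1 r' hr'
    rcases kr with kr | kr | kr <;> linarith
  · have := h1 p' hp'
    rcases kp with kp | kp <;> linarith
  · rcases h1 q' hq' with h2 | h2
    · rw [h2, arc_self] at kq
      rcases kq with kq | kq | kq <;> linarith
    · rcases kq with kq | kq | kq <;> linarith

open Filter Topology in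
/-- Sets that pairwise do not separate each other are eventually thin: for late times no three of
their points are at mutual distance at least `η`. -/
lemma eventually_thin {E : ℕ → Set UnitAddCircle}
    (hE : ∀ s t, s ≠ t → Unseparated (E s) (E t)) {η : ℝ} (hη : 0 < η) :
    ∃ T, ∀ t, T ≤ t → ∀ p ∈ E t, ∀ q ∈ E t, ∀ r ∈ E t,
      η ≤ ‖q - p‖ → η ≤ ‖r - q‖ → ‖r - p‖ < η := by
  by_contra! hcon
  have hfreq : ∃ᶠ t in atTop, ∃ z : UnitAddCircle × UnitAddCircle × UnitAddCircle,
      (z.1 ∈ E t ∧ z.2.1 ∈ E t ∧ z.2.2 ∈ E t) ∧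
        η ≤ ‖z.2.1 - z.1‖ ∧ η ≤ ‖z.2.2 - z.2.1‖ ∧ η ≤ ‖z.2.2 - z.1‖ := by
    rw [frequently_atTop]
    intro T
    obtain ⟨t, ht, p, hp, q, hq, r, hr, h1, h2, h3⟩ := hcon T
    exact ⟨t, ht, (p, q, r), ⟨hp, hq, hr⟩, h1, h2, h3⟩
  obtain ⟨φ, hφ, hz⟩ := extraction_of_frequently_atTop hfreq
  choose z hz using hz
  obtain ⟨a, ψ, hψ, ha⟩ := CompactSpace.tendsto_subseq z
  obtain ⟨N, hN⟩ := Metric.cauchySeq_iff.1 ha.cauchySeq η hη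
  have hd := hN (N + 1) (by omega) N le_rfl
  have hne : φ (ψ N) ≠ φ (ψ (N + 1)) := (hφ (hψ (Nat.lt_succ_self N))).ne
  simp only [Function.comp_apply, Prod.dist_eq, max_lt_iff] at hd
  simp only [dist_eq_norm] at hd
  obtain ⟨⟨h1, h2, h3⟩, h4, h5, h6⟩ := hz (ψ N)
  obtain ⟨⟨g1, g2, g3⟩, -⟩ := hz (ψ (N + 1))
  exact (hE _ _ hne).not_close h1 h2 h3 g1 g2 g3 h4 h5 h6 hd.1 hd.2.1 hd.2.2

/-- The set `S` is `ε`-separated. -/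
def EpsSeparated (ε : ℝ) (S : Set UnitAddCircle) : Prop :=
  ∀ p ∈ S, ∀ q ∈ S, p ≠ q → ε ≤ ‖q - p‖

/-- A near collision in `E`: two points `u, v` of `E` whose images under `x ↦ d x` are `ε`-close,
although `v - u` is close to `j / d`, together with a third point `w = u + δ` of `E` that is near
`u` but at distance at least `ε` from it. The data `(n, j, b)` record the approximate position `n`
of `u`, the index `j`, and the side `b` of `u` on which `w` lies. -/
def NearCollision (d : ℕ) (ε : ℝ) (E : Set UnitAddCircle) (c : ℕ × ℕ × Bool) : Prop :=
  ∃ u ∈ E, ∃ θ δ : ℝ, u + ((c.2.1 / d + θ : ℝ) : UnitAddCircle) ∈ E ∧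
    u + (δ : UnitAddCircle) ∈ E ∧ ⌊8 * d * arc 0 u⌋₊ = c.1 ∧ |θ| * d < ε ∧ ε ≤ |δ| ∧
    |δ| * (4 * d) ≤ 1 ∧ (0 < δ ↔ c.2.2 = true)

lemma arc_add_coe {u : UnitAddCircle} {t : ℝ} (h0 : 0 ≤ t) (h1 : t < 1) :
    arc u (u + (t : UnitAddCircle)) = t :=
  arc_eq_of_coe_eq h0 h1 (by abel)

lemma arc_add_coe_neg {u : UnitAddCircle} {t : ℝ} (h0 : -1 ≤ t) (h1 : t < 0) :
    arc u (u + (t : UnitAddCircle)) = t + 1 :=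
  arc_eq_of_coe_eq (by linarith) (by linarith) (by
    rw [AddCircle.coe_add, AddCircle.coe_period]; abel)

/-- Two near collisions of the same kind are incompatible: since `2 ε / d ≤ ε`, the points `u, v` of
the second one would have to lie so close to those of the first one that its third point is
separated from them. -/
lemma NearCollision.false {d : ℕ} (hd : 2 ≤ d) {ε : ℝ} (hε : ε ≤ 1 / 8)
    {E E' : Set UnitAddCircle} (hEE : Unseparated E E') {c : ℕ × ℕ × Bool}
    (hj : 1 ≤ c.2.1) (hj' : c.2.1 + 1 ≤ d) (h : NearCollision d ε E c)
    (h' : NearCollision d ε E' c) : False := by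
  obtain ⟨u, hu, θ, δ, hv, hw, hbox, hθ, hδ, hδ', hsign⟩ := h
  obtain ⟨u', hu', θ', δ', hv', hw', hbox', hθ', hδ1, hδ1', hsign'⟩ := h'
  have hdR : (2 : ℝ) ≤ d := by exact_mod_cast hd
  have hdpos : (0 : ℝ) < d := by linarith
  -- everything is measured in units of `1 / (8 * d)`
  set κ : ℝ := 1 / (8 * d) with hκ
  have hκpos : 0 < κ := by positivity
  have hdκ : d * κ = 1 / 8 := by rw [hκ]; field_simp
  set τ : ℝ := (c.2.1 : ℝ) / d with hτ
  have hτ1 : 8 * κ ≤ τ := by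
    have : (1 : ℝ) ≤ c.2.1 := by exact_mod_cast hj
    have e : 8 * κ = 1 / d := by rw [hκ]; field_simp
    rw [e, hτ]; gcongr
  have hτ2 : τ ≤ 1 - 8 * κ := by
    have : (c.2.1 : ℝ) + 1 ≤ d := by exact_mod_cast hj'
    have e : 8 * κ = 1 / d := by rw [hκ]; field_simp
    rw [e, hτ, le_sub_iff_add_le, ← add_div, div_le_one hdpos]; exact this
  have hθκ : |θ| < κ := by
    by_contra! hc
    nlinarith [mul_le_mul_of_nonneg_left hc hdpos.le]
  have hθκ' : |θ'| < κ := by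
    by_contra! hc
    nlinarith [mul_le_mul_of_nonneg_left hc hdpos.le]
  have hθε : |θ| < ε / 2 := by nlinarith [abs_nonneg θ]
  have hθε' : |θ'| < ε / 2 := by nlinarith [abs_nonneg θ']
  have hδκ : |δ| ≤ 2 * κ := by
    by_contra! hc
    nlinarith [mul_lt_mul_of_pos_left hc hdpos]
  have hδκ' : |δ'| ≤ 2 * κ := by
    by_contra! hc
    nlinarith [mul_lt_mul_of_pos_left hc hdpos]
  obtain ⟨s, hs, hus⟩ : ∃ s : ℝ, |s| < κ ∧ u' = u + (s : UnitAddCircle) := by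
    refine ⟨arc 0 u' - arc 0 u, ?_, by
      rw [AddCircle.coe_sub, coe_arc, coe_arc]; abel⟩
    have e0 : 0 ≤ 8 * d * arc 0 u := by have := arc_nonneg 0 u; positivity
    have e0' : 0 ≤ 8 * d * arc 0 u' := by have := arc_nonneg 0 u'; positivity
    have f1 := Nat.floor_le e0
    have f2 := Nat.lt_floor_add_one (8 * d * arc 0 u)
    have f3 := Nat.floor_le e0'
    have f4 := Nat.lt_floor_add_one (8 * d * arc 0 u')
    rw [hbox] at f1 f2
    rw [hbox'] at f3 f4
    have : |8 * d * (arc 0 u' - arc 0 u)| < 1 := by rw [abs_lt]; constructor <;> linarith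
    rw [abs_mul, abs_of_pos (by positivity : (0 : ℝ) < 8 * d)] at this
    rw [hκ, lt_div_iff₀ (by positivity)]
    linarith
  have hεpos : 0 < ε := by linarith [abs_nonneg θ]
  have hκ1 : κ ≤ 1 / 16 := by nlinarith
  have e' : u' + ((τ + θ' : ℝ) : UnitAddCircle) = u + ((s + τ + θ' : ℝ) : UnitAddCircle) := by
    rw [hus, add_assoc, ← AddCircle.coe_add]; congr 2; ring
  have ew : u' + (δ' : UnitAddCircle) = u + ((s + δ' : ℝ) : UnitAddCircle) := by
    rw [hus, add_assoc, ← AddCircle.coe_add]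
  rw [e'] at hv'
  rw [ew] at hw'
  rw [hus] at hu'
  rw [abs_lt] at hs hθκ hθκ' hθε hθε'
  have av := arc_add_coe (u := u) (t := τ + θ) (by linarith) (by linarith)
  have av' := arc_add_coe (u := u) (t := s + τ + θ') (by linarith) (by linarith)
  rw [abs_le] at hδκ hδκ'
  by_cases hpos : 0 < δ
  · have hpos' : 0 < δ' := hsign'.2 (hsign.1 hpos)
    rw [abs_of_pos hpos] at hδ
    rw [abs_of_pos hpos'] at hδ1
    have aw := arc_add_coe (u := u) (t := δ) (by linarith) (by linarith)
    rcases hEE u hu _ hw _ hv (by rw [aw]; linarith) (by rw [aw, av]; linarith) with h | h | h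
    · have := h _ hv'
      rw [aw, av'] at this
      linarith
    · have h1 := h _ hu'
      have h2 := h _ hv'
      rw [av, av', aw] at h2
      rw [aw, av] at h1
      by_cases hs0 : 0 ≤ s
      · rw [arc_add_coe hs0 (by linarith)] at h1
        linarith
      · rw [arc_add_coe_neg (by linarith) (by linarith)] at h1
        linarith
    · have h1 : τ + θ ≤ s + τ + θ' := by
        rcases h _ hv' with h1 | h1
        · rw [h1, arc_self] at av'; linarith
        · rwa [av, av'] at h1
      have a3 := arc_add_coe (u := u) (t := s + δ') (by linarith) (by linarith)
      rcases h _ hw' with h2 | h2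
      · rw [h2, arc_self] at a3; linarith
      · rw [av, a3] at h2; linarith
  · have hpos' : ¬ 0 < δ' := fun h => hpos (hsign.2 (hsign'.1 h))
    rw [abs_of_nonpos (not_lt.1 hpos)] at hδ
    rw [abs_of_nonpos (not_lt.1 hpos')] at hδ1
    have aw := arc_add_coe_neg (u := u) (t := δ) (by linarith) (by linarith)
    rcases hEE u hu _ hv _ hw (by rw [av]; linarith) (by rw [aw, av]; linarith) with h | h | h
    · have h1 : s + τ + θ' ≤ τ + θ := by
        have := h _ hv'
        rwa [av, av'] at this
      have h2 := h _ hw'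
      rw [arc_add_coe_neg (by linarith) (by linarith), av] at h2
      linarith
    · have h1 := h _ hu'
      have h2 := h _ hv'
      rw [av, av', aw] at h2
      rw [aw, av] at h1
      by_cases hs0 : 0 ≤ s
      · rw [arc_add_coe hs0 (by linarith)] at h1
        linarith
      · rw [arc_add_coe_neg (by linarith) (by linarith)] at h1
        linarith
    · rcases h _ hv' with h1 | h1
      · rw [h1, arc_self] at av'; linarith
      · rw [aw, av'] at h1; linarith

/-! ### Finiteness of sets with unseparated images -/

lemma exists_coe_eq_abs_eq_norm (x : UnitAddCircle) :
    ∃ t : ℝ, (t : UnitAddCircle) = x ∧ |t| = ‖x‖ := by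
  have hx : ((arc 0 x : ℝ) : UnitAddCircle) = x := by rw [coe_arc, sub_zero]
  refine ⟨arc 0 x - round (arc 0 x), ?_, ?_⟩
  · rw [AddCircle.coe_sub, hx]
    have : (((round (arc 0 x) : ℤ) : ℝ) : UnitAddCircle) = 0 :=
      (AddCircle.coe_eq_zero_iff (1 : ℝ)).2 ⟨round (arc 0 x), by simp⟩
    rw [this, sub_zero]
  · conv_rhs => rw [← hx, UnitAddCircle.norm_eq]

lemma norm_nsmul_of_le {d : ℕ} {x : UnitAddCircle} (h : ‖x‖ * (2 * d) ≤ 1) :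
    ‖d • x‖ = d * ‖x‖ := by
  obtain ⟨t, rfl, ht⟩ := exists_coe_eq_abs_eq_norm x
  rw [← ht] at h ⊢
  rw [← AddCircle.coe_nsmul, nsmul_eq_mul,
    ((AddCircle.norm_coe_eq_abs_iff (1 : ℝ) one_ne_zero).2 _), abs_mul, Nat.abs_cast]
  rw [abs_mul, Nat.abs_cast, abs_one]
  linarith

section Step

variable {d : ℕ} {ε : ℝ} {E E' : Set UnitAddCircle}

lemma EpsSeparated.image (hε : 0 < ε) {S : Finset UnitAddCircle}
    (h : ∀ p ∈ S, ∀ q ∈ S, p ≠ q → ε ≤ ‖d • q - d • p‖) :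
    EpsSeparated ε (S.image (d • ·) : Finset UnitAddCircle) ∧ (S.image (d • ·)).card = S.card := by
  constructor
  · intro p hp q hq hpq
    simp only [Finset.coe_image, Set.mem_image, Finset.mem_coe] at hp hq
    obtain ⟨p, hp, rfl⟩ := hp
    obtain ⟨q, hq, rfl⟩ := hq
    exact h p hp q hq fun he => hpq (by rw [he])
  · refine Finset.card_image_of_injOn fun p hp q hq hpq => ?_
    by_contra hne
    have := h p hp q hq hne
    rw [show d • p = d • q from hpq, sub_self, norm_zero] at this
    linarith

/-- The map `x ↦ d x` keeps nearby points of an `ε`-separated set `ε`-separated. -/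
lemma EpsSeparated.le_norm_nsmul (hd : 2 ≤ d) {S : Set UnitAddCircle} (hS : EpsSeparated ε S)
    {p q : UnitAddCircle} (hp : p ∈ S) (hq : q ∈ S) (hne : p ≠ q) (hclose : ‖q - p‖ * (2 * d) ≤ 1) :
    ε ≤ ‖d • q - d • p‖ := by
  have hdR : (2 : ℝ) ≤ d := by exact_mod_cast hd
  rw [← smul_sub, norm_nsmul_of_le hclose]
  nlinarith [hS p hp q hq hne, norm_nonneg (q - p)]

/-- Under the map `x ↦ d x` at least half of an `ε`-separated subset of a thin set survives. -/
lemma exists_half_separated (hd : 2 ≤ d) (hε : 0 < ε)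
    (hthin : ∀ p ∈ E, ∀ q ∈ E, ∀ r ∈ E, 1 / (8 * d : ℝ) ≤ ‖q - p‖ → 1 / (8 * d : ℝ) ≤ ‖r - q‖ →
      ‖r - p‖ < 1 / (8 * d : ℝ)) (hmap : ∀ p ∈ E, d • p ∈ E')
    {S : Finset UnitAddCircle} (hSE : ↑S ⊆ E) (hS : EpsSeparated ε S) :
    ∃ S' : Finset UnitAddCircle, ↑S' ⊆ E' ∧ EpsSeparated ε S' ∧ S.card ≤ 2 * S'.card := by
  classical
  have hdR : (2 : ℝ) ≤ d := by exact_mod_cast hd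
  have hη : 1 / (8 * d : ℝ) * (8 * d) = 1 := by field_simp
  rcases S.eq_empty_or_nonempty with rfl | ⟨o, ho⟩
  · exact ⟨∅, by simp, by intro p hp; simp at hp, by simp⟩
  have aux : ∀ U ⊆ S, (∀ p ∈ U, ∀ q ∈ U, ‖q - p‖ * (2 * d) ≤ 1) → S.card ≤ 2 * U.card →
      ∃ S' : Finset UnitAddCircle, ↑S' ⊆ E' ∧ EpsSeparated ε S' ∧ S.card ≤ 2 * S'.card := by
    intro U hU hclose hcard
    obtain ⟨h1, h2⟩ := EpsSeparated.image hε (S := U) fun p hp q hq hne =>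
      hS.le_norm_nsmul hd (hU hp) (hU hq) hne (hclose p hp q hq)
    refine ⟨U.image (d • ·), ?_, h1, by rw [h2]; exact hcard⟩
    intro z hz
    simp only [Finset.coe_image, Set.mem_image, Finset.mem_coe] at hz
    obtain ⟨p, hp, rfl⟩ := hz
    exact hmap p (hSE (hU hp))
  have hsum := Finset.card_filter_add_card_filter_not (s := S) (fun p => ‖p - o‖ < 1 / (8 * d : ℝ))
  by_cases hc : S.card ≤ 2 * (S.filter (fun p => ‖p - o‖ < 1 / (8 * d : ℝ))).card
  · refine aux _ (Finset.filter_subset _ _) ?_ hc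
    intro p hp q hq
    have hp := (Finset.mem_filter.1 hp).2
    have hq := (Finset.mem_filter.1 hq).2
    have h1 : ‖q - p‖ ≤ ‖q - o‖ + ‖p - o‖ := by
      have := norm_sub_le (q - o) (p - o)
      rwa [sub_sub_sub_cancel_right] at this
    nlinarith
  · refine aux (S.filter (fun p => ¬ ‖p - o‖ < 1 / (8 * d : ℝ))) (Finset.filter_subset _ _) ?_
      (by omega)
    intro p hp q hq
    obtain ⟨hpS, hp⟩ := Finset.mem_filter.1 hp
    obtain ⟨hqS, hq⟩ := Finset.mem_filter.1 hq
    by_contra! hcon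
    have h1 : 1 / (8 * d : ℝ) ≤ ‖q - p‖ := by
      by_contra! h1
      nlinarith
    exact hq (hthin o (hSE ho) p (hSE hpS) q (hSE hqS) (not_lt.1 hp) h1)

/-- Unless there is a near collision, the map `x ↦ d x` keeps all of an `ε`-separated subset with at
least three elements of a thin set. -/
lemma nearCollision_or_exists_separated (hd : 2 ≤ d) (hε : 0 < ε) (hε' : ε ≤ 1 / 8)
    (hthin : ∀ p ∈ E, ∀ q ∈ E, ∀ r ∈ E, 1 / (8 * d : ℝ) ≤ ‖q - p‖ → 1 / (8 * d : ℝ) ≤ ‖r - q‖ →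
      ‖r - p‖ < 1 / (8 * d : ℝ)) (hmap : ∀ p ∈ E, d • p ∈ E')
    {S : Finset UnitAddCircle} (hSE : ↑S ⊆ E) (hS : EpsSeparated ε S) (hcard : 3 ≤ S.card) :
    (∃ c : ℕ × ℕ × Bool, c.1 < 8 * d ∧ 1 ≤ c.2.1 ∧ c.2.1 + 1 ≤ d ∧ NearCollision d ε E c) ∨
      ∃ S' : Finset UnitAddCircle, ↑S' ⊆ E' ∧ EpsSeparated ε S' ∧ S'.card = S.card := by
  classical
  have hdR : (2 : ℝ) ≤ d := by exact_mod_cast hd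
  have hη : 1 / (8 * d : ℝ) * (8 * d) = 1 := by field_simp
  by_cases hall : ∀ p ∈ S, ∀ q ∈ S, p ≠ q → ε ≤ ‖d • q - d • p‖
  · right
    obtain ⟨h1, h2⟩ := EpsSeparated.image hε hall
    refine ⟨S.image (d • ·), ?_, h1, h2⟩
    intro z hz
    simp only [Finset.coe_image, Set.mem_image, Finset.mem_coe] at hz
    obtain ⟨p, hp, rfl⟩ := hz
    exact hmap p (hSE hp)
  left
  push Not at hall
  obtain ⟨p, hp, q, hq, hne, hlt⟩ := hall
  have hfar : 1 / (8 * d : ℝ) ≤ ‖q - p‖ := by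
    by_contra! hc
    exact absurd (hS.le_norm_nsmul hd hp hq hne (by nlinarith)) (not_le.2 hlt)
  obtain ⟨r, hr, hrne⟩ : ∃ r ∈ S, r ∉ ({p, q} : Finset UnitAddCircle) :=
    Finset.exists_mem_notMem_of_card_lt_card (Finset.card_le_two.trans_lt (by omega))
  simp only [Finset.mem_insert, Finset.mem_singleton, not_or] at hrne
  obtain ⟨u, hu, v, hv, huv, hcol, hru, hur⟩ : ∃ u ∈ S, ∃ v ∈ S, u ≠ v ∧ ‖d • v - d • u‖ < ε ∧
      r ≠ u ∧ ‖r - u‖ < 1 / (8 * d : ℝ) := by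
    by_cases h : 1 / (8 * d : ℝ) ≤ ‖r - q‖
    · exact ⟨p, hp, q, hq, hne, hlt, hrne.1, hthin p (hSE hp) q (hSE hq) r (hSE hr) hfar h⟩
    · exact ⟨q, hq, p, hp, hne.symm, by rwa [norm_sub_rev], hrne.2, not_le.1 h⟩
  have hsep := hS u hu v hv huv
  have hτ0 := arc_nonneg u v
  have hτ1 := arc_lt_one u v
  have hτ2 := norm_sub_le_arc u v
  have hτ3 := norm_sub_le_one_sub_arc u v
  have hcoe : d • v - d • u = ((d * arc u v : ℝ) : UnitAddCircle) := by
    rw [← smul_sub, ← coe_arc, ← AddCircle.coe_nsmul, nsmul_eq_mul]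
  rw [hcoe, UnitAddCircle.norm_eq] at hcol
  set m := round (d * arc u v) with hm
  have hcol' := abs_lt.1 hcol
  have hm0 : 0 < m := by
    by_contra! hc
    have : (m : ℝ) ≤ 0 := by exact_mod_cast hc
    nlinarith
  have hmd : m < d := by
    by_contra! hc
    have : (d : ℝ) ≤ m := by exact_mod_cast hc
    nlinarith
  have hmn : (m.toNat : ℝ) = m := by exact_mod_cast Int.toNat_of_nonneg hm0.le
  obtain ⟨δ, hδ, hδ'⟩ := exists_coe_eq_abs_eq_norm (r - u)
  refine ⟨(⌊8 * d * arc 0 u⌋₊, m.toNat, decide (0 < δ)), ?_, ?_, ?_, u, hSE hu,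
    arc u v - m / d, δ, ?_, ?_, rfl, ?_, ?_, ?_, ?_⟩
  · rw [Nat.floor_lt (by have := arc_nonneg 0 u; positivity)]
    push_cast
    nlinarith [arc_lt_one 0 u]
  · simp only; omega
  · simp only; omega
  · simp only [hmn]
    rw [add_sub_cancel, coe_arc, add_sub_cancel]
    exact hSE hv
  · rw [hδ, add_sub_cancel]; exact hSE hr
  · rw [← abs_of_nonneg (by linarith : (0 : ℝ) ≤ d), ← abs_mul, sub_mul, abs_of_nonneg
      (by linarith : (0 : ℝ) ≤ d), div_mul_cancel₀ _ (by linarith), mul_comm]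
    exact hcol
  · rw [hδ']; exact hS u hu r hr (Ne.symm hru)
  · rw [hδ']; nlinarith
  · simp

end Step

/-- A set all of whose images under iterates of `x ↦ d x` are pairwise unseparated is finite. -/
theorem finite_of_unseparated {d : ℕ} (hd : 2 ≤ d) {E : ℕ → Set UnitAddCircle}
    (hstep : ∀ t, E (t + 1) = (d • ·) '' E t)
    (hE : ∀ s t, s ≠ t → Unseparated (E s) (E t)) : (E 0).Finite := by
  classical
  have hdR : (2 : ℝ) ≤ d := by exact_mod_cast hd
  by_contra hinf
  have hmap : ∀ t, ∀ p ∈ E t, d • p ∈ E (t + 1) := fun t p hp => hstep t ▸ ⟨p, hp, rfl⟩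
  -- the map `x ↦ d x` is finite-to-one, so all `E t` are infinite
  have hinfin : ∀ t, (E t).Infinite := by
    intro t
    induction t with
    | zero => exact hinf
    | succ t ih =>
      rw [hstep]
      intro hfin
      refine ih ((hfin.preimage' fun b _ => ?_).subset (Set.subset_preimage_image _ _))
      rcases Set.eq_empty_or_nonempty ((d • · : UnitAddCircle → UnitAddCircle) ⁻¹' {b})
        with h | ⟨z, hz⟩
      · rw [h]; exact Set.finite_empty
      · have hfin := (AddCircle.finite_torsion (1 : ℝ) (n := d) (by omega))
        refine (hfin.image (z + ·)).subset fun w hw => ⟨w - z, ?_, by simp⟩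
        simp only [Set.mem_preimage, Set.mem_singleton_iff] at hz hw
        simp [smul_sub, hz, hw]
  obtain ⟨T, hT⟩ := eventually_thin hE (η := 1 / (8 * d : ℝ)) (by positivity)
  -- `M` bounds the number of kinds of near collisions; a set of `3 * 2 ^ M` points has to be halved
  -- at least `M + 1` times before fewer than three of its points are left
  set M := 8 * d * (d * 2) with hM
  obtain ⟨S₀, hS₀, hcard₀⟩ := (hinfin T).exists_subset_card_eq (3 * 2 ^ M)
  obtain ⟨ε, hε, hε', hsep₀⟩ : ∃ ε : ℝ, 0 < ε ∧ ε ≤ 1 / 8 ∧ EpsSeparated ε S₀ := by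
    have hne : (insert (1 / 8 : ℝ) (S₀.offDiag.image fun z => ‖z.2 - z.1‖)).Nonempty :=
      Finset.insert_nonempty _ _
    refine ⟨Finset.min' _ hne, ?_, Finset.min'_le _ (1 / 8 : ℝ) (Finset.mem_insert_self _ _),
      fun p hp q hq hpq => ?_⟩
    · rw [Finset.lt_min'_iff _ hne]
      intro y hy
      rw [Finset.mem_insert, Finset.mem_image] at hy
      rcases hy with rfl | ⟨z, hz, rfl⟩
      · norm_num
      · rw [Finset.mem_offDiag] at hz
        exact norm_pos_iff.2 (sub_ne_zero.2 hz.2.2.symm)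
    · exact Finset.min'_le _ _ (Finset.mem_insert_of_mem (Finset.mem_image.2
        ⟨(p, q), Finset.mem_offDiag.2 ⟨hp, hq, hpq⟩, rfl⟩))
  obtain ⟨T', hT'⟩ := eventually_thin hE hε
  have hlate : ∀ t, T' ≤ t → ∀ S : Finset UnitAddCircle, ↑S ⊆ E t → EpsSeparated ε S →
      ¬ 3 ≤ S.card := by
    intro t ht S hSE hS hc
    obtain ⟨p, q, r, hp, hq, hr, hpq, hpr, hqr⟩ := Finset.two_lt_card_iff.1 hc
    exact absurd (hT' t ht p (hSE hp) q (hSE hq) r (hSE hr) (hS p hp q hq hpq) (hS q hq r hr hqr))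
      (not_lt.2 (hS p hp r hr hpr))
  let Ev : ℕ → Prop := fun t =>
    ∃ c : ℕ × ℕ × Bool, c.1 < 8 * d ∧ 1 ≤ c.2.1 ∧ c.2.1 + 1 ≤ d ∧ NearCollision d ε (E t) c
  let Q : ℕ → ℕ → Prop := fun n t =>
    ∃ S : Finset UnitAddCircle, ↑S ⊆ E t ∧ EpsSeparated ε S ∧ n ≤ S.card
  -- each halving of the size of a maximal `ε`-separated set requires a near collision
  have hdrop : ∀ n, 3 ≤ n → ∀ t, T ≤ t → Q n t →
      ∃ t', t ≤ t' ∧ Ev t' ∧ ∀ k, n = 2 * k → Q k (t' + 1) := by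
    intro n hn t ht hQ
    obtain ⟨t', htt', hQ', hQ''⟩ : ∃ t', t ≤ t' ∧ Q n t' ∧ ¬ Q n (t' + 1) := by
      by_contra! hcon
      have : ∀ k, Q n (t + k) := by
        intro k
        induction k with
        | zero => exact hQ
        | succ k ih => exact hcon (t + k) (by omega) ih
      obtain ⟨S, h1, h2, h3⟩ := this T'
      exact hlate _ (by omega) S h1 h2 (hn.trans h3)
    obtain ⟨S, h1, h2, h3⟩ := hQ'
    refine ⟨t', htt', ?_, fun k hk => ?_⟩
    · rcases nearCollision_or_exists_separated hd hε hε' (hT t' (by omega)) (hmap t') h1 h2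
        (hn.trans h3) with h | ⟨S', g1, g2, g3⟩
      · exact h
      · exact absurd ⟨S', g1, g2, g3 ▸ h3⟩ hQ''
    · obtain ⟨S', g1, g2, g3⟩ := exists_half_separated hd hε (hT t' (by omega)) (hmap t') h1 h2
      exact ⟨S', g1, g2, by omega⟩
  have hmany : ∀ m t, T ≤ t → Q (3 * 2 ^ m) t →
      ∃ R : Finset ℕ, R.card = m + 1 ∧ ∀ s ∈ R, t ≤ s ∧ Ev s := by
    intro m
    induction m with
    | zero =>
      intro t ht hQ
      obtain ⟨t', h1, h2, -⟩ := hdrop 3 le_rfl t ht (by simpa using hQ)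
      exact ⟨{t'}, by simp, by simp [h1, h2]⟩
    | succ m ih =>
      intro t ht hQ
      obtain ⟨t', h1, h2, h3⟩ := hdrop (3 * 2 ^ (m + 1))
        (by have := Nat.one_le_two_pow (n := m + 1); omega) t ht hQ
      obtain ⟨R, hR, hR'⟩ := ih (t' + 1) (by omega) (h3 _ (by rw [pow_succ]; ring))
      refine ⟨insert t' R, ?_, ?_⟩
      · rw [Finset.card_insert_of_notMem, hR]
        intro h
        have := (hR' t' h).1
        omega
      · intro s hs
        rcases Finset.mem_insert.1 hs with rfl | hs
        · exact ⟨h1, h2⟩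
        · exact ⟨by have := (hR' s hs).1; omega, (hR' s hs).2⟩
  obtain ⟨R, hR, hR'⟩ := hmany M T le_rfl ⟨S₀, hS₀, hsep₀, hcard₀.ge⟩
  have hEv : ∀ s, ∃ c : ℕ × ℕ × Bool, s ∈ R →
      c.1 < 8 * d ∧ 1 ≤ c.2.1 ∧ c.2.1 + 1 ≤ d ∧ NearCollision d ε (E s) c := by
    intro s
    by_cases hs : s ∈ R
    · obtain ⟨c, hc⟩ := (hR' s hs).2
      exact ⟨c, fun _ => hc⟩
    · exact ⟨(0, 0, true), fun h => absurd h hs⟩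
  choose c hc using hEv
  obtain ⟨s, hs, t, ht, hst, hcst⟩ := Finset.exists_ne_map_eq_of_card_lt_of_maps_to
    (s := R) (t := Finset.range (8 * d) ×ˢ (Finset.range d ×ˢ (Finset.univ : Finset Bool))) (f := c)
    (by simp [hR, ← hM]) (fun s hs => by
      obtain ⟨h1, h2, h3, -⟩ := hc s hs
      simp only [Finset.coe_product, Set.mem_prod, Finset.coe_range, Set.mem_Iio, Finset.coe_univ,
        Set.mem_univ, and_true]
      exact ⟨h1, by omega⟩)
  obtain ⟨h1, h2, h3, h4⟩ := hc s hs
  have h5 := (hc t ht).2.2.2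
  rw [← hcst] at h5
  exact h4.false hd hε' (hE s t hst) h2 h3 h5

/-! ### Chains of crossing chords -/

/-- The circular order `p < q < r ≤ s < t < u ≤ p` of six points: for two unlinked chords `p r` and
`s u`, both crossed by the chord `q t`, this says that `(p, r)` is the side of the first chord away
from the second one. -/
def Cyc6 (p q r s t u : UnitAddCircle) : Prop :=
  0 < arc p q ∧ arc p q < arc p r ∧ arc p r ≤ arc p s ∧ arc p s < arc p t ∧
    (u = p ∨ arc p t < arc p u)

lemma ArcMono.cyc6 {g : UnitAddCircle → UnitAddCircle} {S : Set UnitAddCircle} (h : ArcMono g S)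
    {p q r s t u : UnitAddCircle} (hp : p ∈ S) (hq : q ∈ S) (hr : r ∈ S) (hs : s ∈ S) (ht : t ∈ S)
    (hu : u ∈ S) (hc : Cyc6 p q r s t u) : Cyc6 (g p) (g q) (g r) (g s) (g t) (g u) := by
  obtain ⟨h1, h2, h3, h4, h5⟩ := hc
  exact ⟨(h.pos_iff hp hq).1 h1, (h p hp q hq r hr).1 h2, (h.le_iff hp hr hs).1 h3,
    (h p hp s hs t ht).1 h4, h5.imp (fun h => by rw [h]) (h p hp t ht u hu).1⟩

lemma Cyc6.neg {p q r s t u : UnitAddCircle} (h : Cyc6 p q r s t u) :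
    Cyc6 (-r) (-q) (-p) (-u) (-t) (-s) := by
  obtain ⟨h1, h2, h3, h4, h5⟩ := h
  have hp := arc_lt_one p t
  simp only [Cyc6, arc_neg]
  rw [arc_rebase p q r, arc_rebase p u r, arc_rebase p t r, arc_rebase p s r]
  rw [if_pos h2.le, if_neg (show ¬ arc p t ≤ arc p r by linarith)]
  refine ⟨by linarith, by linarith, ?_, ?_, ?_⟩
  · rcases h5 with rfl | h5
    · rw [arc_self, if_pos (by linarith)]; linarith
    · have := arc_lt_one p u
      rw [if_neg (by linarith)]; linarith
  · rcases h5 with rfl | h5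
    · rw [arc_self, if_pos (by linarith)]; linarith
    · have := arc_lt_one p u
      rw [if_neg (by linarith)]; linarith
  · rcases h3.eq_or_lt with h3 | h3
    · left; rw [arc_left_inj.1 h3]
    · right; rw [if_neg (by linarith)]; linarith

lemma Crossing.of_neg {a b x y : UnitAddCircle} (h : Crossing (-a) (-b) (-x) (-y)) :
    Crossing a b x y := by
  have aux : ∀ p q r s : UnitAddCircle, Cyc4 (-p) (-q) (-r) (-s) → Cyc4 p s r q := by
    rintro p q r s ⟨h1, h2, h3⟩
    simp only [arc_neg] at h1 h2 h3
    have e : ∀ z, 0 < arc z p → arc p z = 1 - arc z p :=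
      fun z hz => arc_swap (arc_pos_iff.1 hz)
    have := arc_lt_one s p
    refine ⟨?_, ?_, ?_⟩
    · rw [e s (by linarith)]; linarith
    · rw [e s (by linarith), e r (by linarith)]; linarith
    · rw [e q (by linarith), e r (by linarith)]; linarith
  exact h.elim (fun h => Or.inr (aux _ _ _ _ h)) fun h => Or.inl (aux _ _ _ _ h)

/-- Two unlinked chords `a b` and `a' b'` that cross a common chord in opposite directions have
disjoint outer sides. -/
lemma cyc6_or_cyc6 {a b x y a' b' : UnitAddCircle} (h : Cyc4 a y b x) (h' : Cyc4 a' x b' y)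
    (hun : ¬ Crossing a b a' b') : Cyc6 a y b a' x b' ∨ Cyc6 b x a b' y a' := by
  obtain ⟨h1, h2, h3⟩ := h
  have h0 := h'
  rw [Crossing, not_or] at hun
  obtain ⟨hu1, hu2⟩ := hun
  have hx1 := arc_lt_one a x
  have ha0 := arc_nonneg a a'
  have ha1 := arc_lt_one a a'
  have hb0 := arc_nonneg a b'
  have hb1 := arc_lt_one a b'
  have horder : (arc a y < arc a a' ∧ arc a a' < arc a x ∧ arc a x < arc a b') ∨
      (arc a b' < arc a y ∧ arc a y < arc a a' ∧ arc a a' < arc a x) := by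
    obtain ⟨g1, g2, g3⟩ := h'
    simp only [arc_rebase a a'] at g1 g2 g3
    split_ifs at g1 g2 g3 <;> first
      | (exfalso; linarith)
      | (left; refine ⟨?_, ?_, ?_⟩ <;> linarith)
      | (right; refine ⟨?_, ?_, ?_⟩ <;> linarith)
  rcases horder with ⟨g1, g2, g3⟩ | ⟨g1, g2, g3⟩
  · left
    refine ⟨h1, h2, ?_, g2, Or.inr g3⟩
    by_contra! hc
    exact hu1 ⟨by linarith, hc, by linarith⟩
  · by_cases hb : b' = a
    · by_cases hba : arc a b ≤ arc a a'
      · left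
        exact ⟨h1, h2, hba, g3, Or.inl hb⟩
      · right
        rw [hb]
        refine ⟨?_, ?_, ?_, ?_, Or.inr ?_⟩
        · rw [arc_rebase a b x, if_pos h3.le]; linarith
        · rw [arc_rebase a b x, arc_rebase a b a, if_pos h3.le, arc_self, if_neg (by linarith)]
          linarith
        · exact le_rfl
        · rw [arc_rebase a b a, arc_self, arc_rebase a b y, if_neg (by linarith),
            if_neg (by linarith)]
          linarith
        · rw [arc_rebase a b y, arc_rebase a b a', if_neg (by linarith), if_neg (by linarith)]
          linarith
    · right
      have hbp := arc_pos_iff.2 hb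
      have hab : arc a a' ≤ arc a b := by
        by_contra! hc
        exact hu2 ⟨hbp, by linarith, hc⟩
      refine ⟨?_, ?_, ?_, ?_, ?_⟩
      · rw [arc_rebase a b x, if_pos h3.le]; linarith
      · rw [arc_rebase a b x, arc_rebase a b a, if_pos h3.le, arc_self, if_neg (by linarith)]
        linarith
      · rw [arc_rebase a b b', arc_rebase a b a, arc_self, if_neg (by linarith),
          if_neg (by linarith)]
        linarith
      · rw [arc_rebase a b b', arc_rebase a b y, if_neg (by linarith), if_neg (by linarith)]
        linarith
      · rcases hab.eq_or_lt with hab | hab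
        · left; exact arc_left_inj.1 hab
        · right
          rw [arc_rebase a b y, arc_rebase a b a', if_neg (by linarith), if_neg (by linarith)]
          linarith

/-- A chain of chords `(l j, r j)`, moved two steps ahead by `x ↦ D x`, in which each chord crosses
the next one and cuts off a piece of the circle on its outer side, must have further crossings:
otherwise it lifts to a bounded chain of intervals on the line, whose left endpoints converge to a
point fixed by the expanding map. -/
lemma chain_false {l r : ℕ → UnitAddCircle} {D : ℕ} (hD : 2 ≤ D)
    (hl : ∀ j, l (j + 2) = D • l j)
    (hord : ∀ j, Cyc6 (l j) (l (j + 1)) (r j) (l (j + 2)) (r (j + 1)) (r (j + 2)))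
    (hun : ∀ m k, m + 2 ≤ k → ¬ Crossing (l m) (r m) (l k) (r k)) : False := by
  set L : ℕ → ℝ := arcLift l with hL
  set R : ℕ → ℝ := fun j => L j + arc (l j) (r j) with hR
  have hLs : ∀ j, L (j + 1) = L j + arc (l j) (l (j + 1)) := arcLift_succ l
  have c1 : ∀ j, L j < L (j + 1) := fun j => by rw [hLs]; linarith [(hord j).1]
  have hL2 : ∀ j, L (j + 2) = L j + arc (l j) (l (j + 2)) := by
    intro j
    obtain ⟨h1, h2, h3, h4, h5⟩ := hord j
    rw [hLs (j + 1), hLs j, arc_rebase (l j) (l (j + 1)) (l (j + 1 + 1)),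
      if_pos (show arc (l j) (l (j + 1)) ≤ arc (l j) (l (j + 2)) by linarith)]
    change _ + _ + (arc (l j) (l (j + 2)) - _) = _
    ring
  have c2 : ∀ j, L (j + 1) < R j := fun j => by
    simp only [hR]; rw [hLs]; linarith [(hord j).2.1]
  have c3 : ∀ j, R j ≤ L (j + 2) := fun j => by
    simp only [hR]; rw [hL2]; linarith [(hord j).2.2.1]
  have c4 : ∀ j, R (j + 2) ≤ L j + 1 := by
    intro j
    obtain ⟨h1, h2, h3, h4, h5⟩ := hord j
    simp only [hR]
    rw [hL2 j]
    rcases h5 with h5 | h5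
    · rw [h5, arc_rebase (l j) (l (j + 2)) (l j), arc_self, if_neg (by linarith)]; linarith
    · rw [arc_rebase (l j) (l (j + 2)) (r (j + 2)), if_pos (by linarith)]
      linarith [arc_lt_one (l j) (r (j + 2))]
  have hRlt : ∀ j, R j < L j + 1 := fun j => by
    simp only [hR]; linarith [arc_lt_one (l j) (r j)]
  have hcoeL : ∀ j, ((L j : ℝ) : UnitAddCircle) = l j := coe_arcLift l
  have hcoeR : ∀ j, ((R j : ℝ) : UnitAddCircle) = r j := fun j => by
    simp only [hR]; rw [AddCircle.coe_add, hcoeL, coe_arc]; abel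
  have hbound : ∀ k, R k ≤ L 0 + 1 := by
    refine chain_bounded c1 c2 c3 c4 fun m k hmk h1 h2 => ?_
    by_contra! h3
    -- the alternating order `L k < L m + 1 < R k < R m + 1` projects to a crossing on the circle
    refine hun m k hmk (Crossing.symm (Or.inl ?_))
    have e1 : arc (l k) (l m) = L m + 1 - L k := arc_eq_of_coe_eq (by linarith)
      (by linarith [hRlt k]) (by
        rw [AddCircle.coe_sub, AddCircle.coe_add, hcoeL, hcoeL, AddCircle.coe_period, add_zero])
    have hlm : L m < L k := strictMono_nat_of_lt_succ c1 (by omega)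
    have hmk' : R m ≤ L k :=
      (c3 m).trans ((strictMono_nat_of_lt_succ c1).monotone hmk)
    have e2 : arc (l k) (r k) = R k - L k := by simp only [hR]; ring
    have hRL : R m ≠ L k := by
      intro he
      rcases hmk.eq_or_lt with rfl | hlt
      · linarith [c4 m]
      · linarith [c3 m, strictMono_nat_of_lt_succ c1 hlt]
    have e3 : arc (l k) (r m) = R m + 1 - L k := arc_eq_of_coe_eq (by linarith)
      (by linarith [lt_of_le_of_ne hmk' hRL]) (by
        rw [AddCircle.coe_sub, AddCircle.coe_add, hcoeR, hcoeL, AddCircle.coe_period, add_zero])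
    refine ⟨?_, ?_, ?_⟩ <;> simp only [e1, e2, e3] <;> linarith
  obtain ⟨N, hN⟩ := eventually_const_of_monotone (z := fun i => L (2 * i)) hD
    (monotone_nat_of_le_succ fun i => ((c1 (2 * i)).trans (c1 (2 * i + 1))).le) (C := L 0 + 1)
    (fun i => by linarith [hbound (2 * i), c1 (2 * i), c2 (2 * i)])
    (fun i => by
      rw [hcoeL, ← nsmul_eq_mul, AddCircle.coe_nsmul, hcoeL, ← hl]; rfl)
  have := (c1 (2 * N)).trans (c1 (2 * N + 1))
  exact this.ne' (hN N le_rfl)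

/-- The sequence `u 0, v 0, u 1, v 1, …`. -/
def interleave (u v : ℕ → UnitAddCircle) (j : ℕ) : UnitAddCircle :=
  if j % 2 = 0 then u (j / 2) else v (j / 2)

lemma interleave_even (u v : ℕ → UnitAddCircle) (i : ℕ) : interleave u v (2 * i) = u i := by
  rw [interleave, if_pos (by omega)]; congr 1; omega

lemma interleave_odd (u v : ℕ → UnitAddCircle) (i : ℕ) : interleave u v (2 * i + 1) = v i := by
  rw [interleave, if_neg (by omega)]; congr 1; omega

/-- `chain_false` for a chain that alternates between two orbits, whose chords are labelled
separately. -/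
lemma interleaved_chain_false {l r l' r' : ℕ → UnitAddCircle} {D : ℕ} (hD : 2 ≤ D)
    (hl : ∀ i, l (i + 1) = D • l i) (hl' : ∀ i, l' (i + 1) = D • l' i)
    (hord : ∀ i, Cyc6 (l i) (l' i) (r i) (l (i + 1)) (r' i) (r (i + 1)))
    (hord' : ∀ i, Cyc6 (l' i) (l (i + 1)) (r' i) (l' (i + 1)) (r (i + 1)) (r' (i + 1)))
    (hun : ∀ i j, ¬ Crossing (l i) (r i) (l j) (r j))
    (hun' : ∀ i j, ¬ Crossing (l' i) (r' i) (l' j) (r' j))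
    (hmix : ∀ i j, i ≠ j → i ≠ j + 1 → ¬ Crossing (l i) (r i) (l' j) (r' j)) : False := by
  have e2 : ∀ (u v : ℕ → UnitAddCircle) i, interleave u v (2 * i + 2) = u (i + 1) :=
    fun u v i => interleave_even u v (i + 1)
  have e3 : ∀ (u v : ℕ → UnitAddCircle) i, interleave u v (2 * i + 1 + 1) = u (i + 1) :=
    fun u v i => interleave_even u v (i + 1)
  have e4 : ∀ (u v : ℕ → UnitAddCircle) i, interleave u v (2 * i + 1 + 2) = v (i + 1) :=
    fun u v i => interleave_odd u v (i + 1)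
  refine chain_false (l := interleave l l') (r := interleave r r') hD ?_ ?_ ?_
  · intro j
    obtain ⟨i, rfl | rfl⟩ := j.even_or_odd'
    · rw [e2, interleave_even, hl]
    · rw [e4, interleave_odd, hl']
  · intro j
    obtain ⟨i, rfl | rfl⟩ := j.even_or_odd'
    · simp only [e2, interleave_even, interleave_odd]; exact hord i
    · simp only [e3, e4, interleave_odd]; exact hord' i
  · intro m k hmk
    obtain ⟨i, rfl | rfl⟩ := m.even_or_odd' <;> obtain ⟨j, rfl | rfl⟩ := k.even_or_odd' <;>
      simp only [interleave_even, interleave_odd]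
    · exact hun i j
    · exact hmix i j (by omega) (by omega)
    · exact fun h => hmix j i (by omega) (by omega) h.symm
    · exact hun' i j

/-! ### Images of a pair of chords at different times -/

/-- The endpoints of the accordion of the chord `a b` with respect to the orbit of the chord `x y`,
with linkedness expressed through the circular order. -/
def accordionEnds (d : ℕ) (a b x y : UnitAddCircle) : Set UnitAddCircle :=
  {p | p = a ∨ p = b ∨
    ∃ t : ℕ, Crossing a b (d ^ t • x) (d ^ t • y) ∧ (p = d ^ t • x ∨ p = d ^ t • y)}

lemma left_mem_accordionEnds {d : ℕ} {a b x y : UnitAddCircle} : a ∈ accordionEnds d a b x y :=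
  Or.inl rfl

lemma right_mem_accordionEnds {d : ℕ} {a b x y : UnitAddCircle} : b ∈ accordionEnds d a b x y :=
  Or.inr (Or.inl rfl)

lemma Crossing.left_mem {d : ℕ} {a b x y : UnitAddCircle} {t : ℕ}
    (h : Crossing a b (d ^ t • x) (d ^ t • y)) : d ^ t • x ∈ accordionEnds d a b x y :=
  Or.inr (Or.inr ⟨t, h, Or.inl rfl⟩)

lemma Crossing.right_mem {d : ℕ} {a b x y : UnitAddCircle} {t : ℕ}
    (h : Crossing a b (d ^ t • x) (d ^ t • y)) : d ^ t • y ∈ accordionEnds d a b x y :=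
  Or.inr (Or.inr ⟨t, h, Or.inr rfl⟩)

lemma accordionEnds_swap_right {d : ℕ} {a b x y : UnitAddCircle} :
    accordionEnds d a b x y ⊆ accordionEnds d a b y x := by
  rintro p (h | h | ⟨t, h, h'⟩)
  · exact Or.inl h
  · exact Or.inr (Or.inl h)
  · exact Or.inr (Or.inr ⟨t, h.swap_right, h'.symm⟩)

lemma ArcMono.crossing {g : UnitAddCircle → UnitAddCircle} {S : Set UnitAddCircle}
    (h : ArcMono g S) {a b x y : UnitAddCircle} (ha : a ∈ S) (hb : b ∈ S) (hx : x ∈ S)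
    (hy : y ∈ S) (hc : Crossing a b x y) : Crossing (g a) (g b) (g x) (g y) :=
  hc.imp (h.cyc4_iff ha hx hb hy).1 (h.cyc4_iff ha hy hb hx).1

lemma pow_smul_pow_smul (d m n : ℕ) (x : UnitAddCircle) :
    d ^ m • d ^ n • x = d ^ (n + m) • x := by
  rw [smul_smul, ← pow_add, add_comm]

/-- The map `x ↦ d x` preserves the circular order on the accordions of all forward images of `a b`
with respect to the orbit of `x y`. -/
def MonoAccordions (d : ℕ) (a b x y : UnitAddCircle) : Prop :=
  ∀ s : ℕ, ArcMono (d • ·) (accordionEnds d (d ^ s • a) (d ^ s • b) x y)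

/-- Iterates of `x ↦ d x` preserve the order on accordions as well, since they map accordions into
accordions. -/
lemma MonoAccordions.iterate {d : ℕ} {a b x y : UnitAddCircle} (h : MonoAccordions d a b x y)
    (s n : ℕ) : ArcMono (d ^ n • ·) (accordionEnds d (d ^ s • a) (d ^ s • b) x y) := by
  suffices H : ArcMono (d ^ n • ·) (accordionEnds d (d ^ s • a) (d ^ s • b) x y) ∧
      Set.MapsTo (d ^ n • ·) (accordionEnds d (d ^ s • a) (d ^ s • b) x y)
        (accordionEnds d (d ^ (s + n) • a) (d ^ (s + n) • b) x y) from H.1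
  have e : ∀ n (p : UnitAddCircle), d ^ (n + 1) • p = d • d ^ n • p := fun n p => by
    rw [smul_smul, pow_succ']
  induction n with
  | zero => simp [ArcMono, Set.MapsTo]
  | succ n ih =>
    obtain ⟨h1, h2⟩ := ih
    have hfun : (fun p : UnitAddCircle => d ^ (n + 1) • p) = (d • ·) ∘ (d ^ n • ·) :=
      funext fun p => e n p
    rw [hfun]
    refine ⟨(h (s + n)).comp h1 h2, Set.MapsTo.comp ?_ h2⟩
    rintro p (rfl | rfl | ⟨t, hc, hp⟩)
    · simp only [← e]; exact left_mem_accordionEnds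
    · simp only [← e]; exact right_mem_accordionEnds
    · have hc' := (h (s + n)).crossing left_mem_accordionEnds right_mem_accordionEnds
        hc.left_mem hc.right_mem hc
      simp only [← e] at hc'
      rcases hp with rfl | rfl
      · simp only [← e]; exact hc'.left_mem
      · simp only [← e]; exact hc'.right_mem

/-- The orbit of the pair of points `a, b` under `x ↦ d x` is infinite. -/
def Wandering (d : ℕ) (a b : UnitAddCircle) : Prop :=
  ∀ i k : ℕ, 0 < k → ¬ (d ^ (i + k) • a = d ^ i • a ∧ d ^ (i + k) • b = d ^ i • b)

/-- Two crossing chords `a b` and `x y`, each of them with pairwise unlinked images, whose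
accordions with respect to each other are mutually order preserving. -/
structure AccordionPair (d : ℕ) (a b x y : UnitAddCircle) : Prop where
  cyc : Cyc4 a x b y
  unlinked_left : ∀ i j : ℕ, ¬ Crossing (d ^ i • a) (d ^ i • b) (d ^ j • a) (d ^ j • b)
  unlinked_right : ∀ i j : ℕ, ¬ Crossing (d ^ i • x) (d ^ i • y) (d ^ j • x) (d ^ j • y)
  mono_left : MonoAccordions d a b x y
  mono_right : MonoAccordions d x y a b

lemma AccordionPair.symm {d : ℕ} {a b x y : UnitAddCircle} (h : AccordionPair d a b x y) :
    AccordionPair d x y b a where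
  cyc := h.cyc.rotate
  unlinked_left := h.unlinked_right
  unlinked_right i j hc := h.unlinked_left i j hc.swap_left.swap_right
  mono_left s := (h.mono_right s).mono accordionEnds_swap_right
  mono_right s := (h.mono_left s).mono (by
    rintro p (hp | hp | ⟨t, hc, hp⟩)
    · exact Or.inr (Or.inl hp)
    · exact Or.inl hp
    · exact Or.inr (Or.inr ⟨t, hc.swap_left, hp⟩))

lemma Wandering.symm {d : ℕ} {a b : UnitAddCircle} (h : Wandering d a b) : Wandering d b a :=
  fun i k hk hc => h i k hk hc.symm

lemma two_le_pow {d k : ℕ} (hd : 2 ≤ d) (hk : 0 < k) : 2 ≤ d ^ k :=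
  hd.trans (Nat.le_self_pow hk.ne' d)

/-- If a wandering chord has two images, on nested sides of each other, and the iterates of
`x ↦ d x` preserve the order of their endpoints, then the nesting persists forever, which is
impossible for an expanding map. -/
lemma Wandering.not_nested {d : ℕ} (hd : 2 ≤ d) {a b : UnitAddCircle} (hw : Wandering d a b)
    {s k : ℕ} (hk : 0 < k) {S : Set UnitAddCircle} (hS : ∀ n : ℕ, ArcMono (d ^ n • ·) S)
    (h1 : d ^ s • a ∈ S) (h2 : d ^ s • b ∈ S) (h3 : d ^ (s + k) • a ∈ S) (h4 : d ^ (s + k) • b ∈ S)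
    (hlt : arc (d ^ s • a) (d ^ (s + k) • a) < arc (d ^ s • a) (d ^ (s + k) • b))
    (hle : arc (d ^ s • a) (d ^ (s + k) • b) ≤ arc (d ^ s • a) (d ^ s • b)) : False := by
  have e : ∀ i, s + k * (i + 1) = s + k * i + k := fun i => by ring
  have e' : ∀ i (p : UnitAddCircle), d ^ (k * i) • d ^ (s + k) • p = d ^ (s + k * i + k) • p :=
    fun i p => by rw [pow_smul_pow_smul]; congr 2; ring
  obtain ⟨i, hi1, hi2⟩ := eventually_fixed_of_nested (u := fun i => d ^ (s + k * i) • a)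
    (v := fun i => d ^ (s + k * i) • b) (two_le_pow hd hk)
    (fun i => by simp only [pow_smul_pow_smul, e]) (fun i => by simp only [pow_smul_pow_smul, e])
    (fun i => by
      have g1 := (hS (k * i) _ h1 _ h3 _ h4).1 hlt
      have g2 := ((hS (k * i)).le_iff h1 h4 h2).1 hle
      simp only [e', pow_smul_pow_smul d (k * i) s] at g1 g2
      simp only [e]
      exact ⟨g1, g2⟩)
  simp only [e] at hi1 hi2
  exact hw _ k hk ⟨hi1, hi2⟩

lemma arc_of_le {o p q : UnitAddCircle} (h : arc o p ≤ arc o q) :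
    arc p q = arc o q - arc o p := by
  rw [arc_rebase o p q, if_pos h]

lemma arc_of_lt {o p q : UnitAddCircle} (h : arc o q < arc o p) :
    arc p q = arc o q - arc o p + 1 := by
  rw [arc_rebase o p q, if_neg (not_le.2 h)]

/-- Unlinked chords `a b` and `a' b'` that cross a common chord in the same direction are nested. -/
lemma nested_of_not_crossing {a b a' b' p q : UnitAddCircle} (h : Cyc4 a p b q)
    (h' : Cyc4 a' p b' q) (hun : ¬ Crossing a b a' b') :
    (arc a a' < arc a b' ∧ arc a b' ≤ arc a b) ∨ (arc b b' < arc b a' ∧ arc b a' ≤ arc b a) := by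
  obtain ⟨g1, g2, g3⟩ := h.rotate.rotate.rotate
  obtain ⟨g1', g2', g3'⟩ := h'.rotate.rotate.rotate
  have hb := arc_lt_one q b
  have hb' := arc_lt_one q b'
  have e1 : arc a b = arc q b - arc q a := arc_of_le (by linarith)
  have e2 : arc a b' = arc q b' - arc q a := arc_of_le (by linarith)
  have e3 : arc b a = arc q a - arc q b + 1 := arc_of_lt (by linarith)
  have e4 : arc b a' = arc q a' - arc q b + 1 := arc_of_lt (by linarith)
  rcases lt_or_ge (arc q a') (arc q a) with ha | ha
  · have e5 : arc a a' = arc q a' - arc q a + 1 := arc_of_lt ha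
    right
    have hbb : arc q b ≤ arc q b' := by
      by_contra! hc
      exact hun (Or.inr ⟨by linarith, by linarith, by linarith⟩)
    rw [e3, e4, arc_of_le hbb]
    constructor <;> linarith
  · have e5 : arc a a' = arc q a' - arc q a := arc_of_le ha
    rcases le_or_gt (arc q b') (arc q b) with hbb | hbb
    · left
      rw [e1, e2, e5]
      constructor <;> linarith
    · rcases ha.eq_or_lt with ha | ha
      · right
        rw [e3, e4, arc_of_le hbb.le]
        constructor <;> linarith
      · exact (hun (Or.inl ⟨by linarith, by linarith, by linarith⟩)).elim

/-- Two unlinked images of a wandering chord cannot cross a common chord in the same direction, if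
the iterates of `x ↦ d x` preserve the order of their endpoints. -/
lemma Wandering.not_parallel {d : ℕ} (hd : 2 ≤ d) {a b : UnitAddCircle} (hw : Wandering d a b)
    {S : Set UnitAddCircle} (hS : ∀ n : ℕ, ArcMono (d ^ n • ·) S) {s s' : ℕ} (hss : s ≠ s')
    (hun : ¬ Crossing (d ^ s • a) (d ^ s • b) (d ^ s' • a) (d ^ s' • b))
    (h1 : d ^ s • a ∈ S) (h2 : d ^ s • b ∈ S) (h3 : d ^ s' • a ∈ S) (h4 : d ^ s' • b ∈ S)
    {p q : UnitAddCircle} (h : Cyc4 (d ^ s • a) p (d ^ s • b) q)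
    (h' : Cyc4 (d ^ s' • a) p (d ^ s' • b) q) : False := by
  wlog hlt : s < s' generalizing s s'
  · exact this hss.symm (fun hc => hun hc.symm) h3 h4 h1 h2 h' h (by omega)
  obtain ⟨k, rfl⟩ := Nat.exists_eq_add_of_lt hlt
  rcases nested_of_not_crossing h h' hun with ⟨n1, n2⟩ | ⟨n1, n2⟩
  · exact hw.not_nested hd (Nat.succ_pos k) hS h1 h2 h3 h4 n1 n2
  · exact hw.symm.not_nested hd (Nat.succ_pos k) hS h2 h1 h4 h3 n1 n2

section Pair

variable {d : ℕ} {a b x y : UnitAddCircle}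

lemma AccordionPair.cyc_iterate (h : AccordionPair d a b x y) (n : ℕ) :
    Cyc4 (d ^ n • a) (d ^ n • x) (d ^ n • b) (d ^ n • y) := by
  have hc : Crossing (d ^ 0 • a) (d ^ 0 • b) (d ^ 0 • x) (d ^ 0 • y) := by
    simpa [Crossing] using Or.inl h.cyc
  have := ((h.mono_left.iterate 0 n).cyc4_iff left_mem_accordionEnds hc.left_mem
    right_mem_accordionEnds hc.right_mem).1 (by simpa using h.cyc)
  simpa using this

lemma AccordionPair.cyc_shift (h : AccordionPair d a b x y) {s t : ℕ}
    (hc : Cyc4 (d ^ s • a) (d ^ t • y) (d ^ s • b) (d ^ t • x)) (n : ℕ) :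
    Cyc4 (d ^ (s + n) • a) (d ^ (t + n) • y) (d ^ (s + n) • b) (d ^ (t + n) • x) := by
  have hc' : Crossing (d ^ s • a) (d ^ s • b) (d ^ t • x) (d ^ t • y) := Or.inr hc
  have := ((h.mono_left.iterate s n).cyc4_iff left_mem_accordionEnds hc'.right_mem
    right_mem_accordionEnds hc'.left_mem).1 hc
  simpa only [pow_smul_pow_smul] using this

/-- Two images of `a b` cannot cross the same image of `x y` in the same direction. -/
lemma AccordionPair.not_parallel (hd : 2 ≤ d) (h : AccordionPair d a b x y)
    (hw : Wandering d a b) {s s' t : ℕ} (hss : s ≠ s') {p q : UnitAddCircle}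
    (hpq : (p = d ^ t • x ∧ q = d ^ t • y) ∨ (p = d ^ t • y ∧ q = d ^ t • x))
    (h1 : Cyc4 (d ^ s • a) p (d ^ s • b) q) (h2 : Cyc4 (d ^ s' • a) p (d ^ s' • b) q) : False := by
  have hc : ∀ r, Cyc4 (d ^ r • a) p (d ^ r • b) q →
      Crossing (d ^ t • x) (d ^ t • y) (d ^ r • a) (d ^ r • b) := by
    intro r hr
    rcases hpq with ⟨rfl, rfl⟩ | ⟨rfl, rfl⟩
    · exact Crossing.symm (Or.inl hr)
    · exact Crossing.symm (Or.inr hr)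
  exact hw.not_parallel hd (h.mono_right.iterate t) hss (h.unlinked_left s s') (hc s h1).left_mem
    (hc s h1).right_mem (hc s' h2).left_mem (hc s' h2).right_mem h1 h2

/-- Images of `a b` and `x y` at different times can only cross in the direction opposite to that
of `a b` and `x y`. -/
lemma AccordionPair.cyc_of_crossing (hd : 2 ≤ d) (h : AccordionPair d a b x y)
    (hw : Wandering d a b) {s t : ℕ} (hst : s ≠ t)
    (hc : Crossing (d ^ s • a) (d ^ s • b) (d ^ t • x) (d ^ t • y)) :
    Cyc4 (d ^ s • a) (d ^ t • y) (d ^ s • b) (d ^ t • x) :=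
  hc.resolve_left fun hc =>
    h.not_parallel hd hw hst (Or.inl ⟨rfl, rfl⟩) hc (h.cyc_iterate t)

/-- An image of `a b` crosses at most one image of `x y` from a different time. -/
lemma AccordionPair.eq_of_cyc (hd : 2 ≤ d) (h : AccordionPair d a b x y)
    (hw : Wandering d x y) {s t t' : ℕ}
    (hc : Cyc4 (d ^ s • a) (d ^ t • y) (d ^ s • b) (d ^ t • x))
    (hc' : Cyc4 (d ^ s • a) (d ^ t' • y) (d ^ s • b) (d ^ t' • x)) : t = t' := by
  by_contra hne
  exact h.symm.not_parallel hd hw (t := s) hne (Or.inr ⟨rfl, rfl⟩)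
    hc.rotate.rotate.rotate hc'.rotate.rotate.rotate

/-- A crossing at times `s < t` would be repeated along the orbit with period `t - s` and produce an
infinite chain of crossing chords. -/
lemma AccordionPair.not_crossing_of_lt (hd : 2 ≤ d) (h : AccordionPair d a b x y)
    (hw : Wandering d a b) (hw' : Wandering d x y) {s t : ℕ} (hst : s < t) :
    ¬ Crossing (d ^ s • a) (d ^ s • b) (d ^ t • x) (d ^ t • y) := by
  intro hcross
  have hrev := h.cyc_of_crossing hd hw hst.ne hcross
  obtain ⟨k, rfl⟩ := Nat.exists_eq_add_of_lt hst
  set K := k + 1 with hK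
  have hKpos : 0 < K := Nat.succ_pos k
  have hD := two_le_pow hd hKpos
  let A : ℕ → UnitAddCircle := fun i => d ^ (s + K * i) • a
  let B : ℕ → UnitAddCircle := fun i => d ^ (s + K * i) • b
  let X : ℕ → UnitAddCircle := fun i => d ^ (s + K * (i + 1)) • x
  let Y : ℕ → UnitAddCircle := fun i => d ^ (s + K * (i + 1)) • y
  have hA : ∀ i, A (i + 1) = d ^ K • A i := fun i => by
    simp only [A, pow_smul_pow_smul]; congr 2; ring
  have hB : ∀ i, B (i + 1) = d ^ K • B i := fun i => by
    simp only [B, pow_smul_pow_smul]; congr 2; ring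
  have hX : ∀ i, X (i + 1) = d ^ K • X i := fun i => by
    simp only [X, pow_smul_pow_smul]; congr 2; ring
  have hY : ∀ i, Y (i + 1) = d ^ K • Y i := fun i => by
    simp only [Y, pow_smul_pow_smul]; congr 2; ring
  have f1 : ∀ i, Cyc4 (A (i + 1)) (X i) (B (i + 1)) (Y i) := fun i => h.cyc_iterate _
  have f2 : ∀ i, Cyc4 (A i) (Y i) (B i) (X i) := fun i => by
    have := h.cyc_shift hrev (K * i)
    have e : s + k + 1 + K * i = s + K * (i + 1) := by rw [hK]; ring
    rwa [e] at this
  have f3 : ∀ i j, ¬ Crossing (A i) (B i) (A j) (B j) := fun i j => h.unlinked_left _ _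
  have f3' : ∀ i j, ¬ Crossing (X i) (Y i) (X j) (Y j) := fun i j => h.unlinked_right _ _
  have f4 : ∀ i j, i ≠ j → i ≠ j + 1 → ¬ Crossing (A i) (B i) (X j) (Y j) := by
    intro i j hij hij' hc
    have hinj : ∀ i j, s + K * i = s + K * j → i = j := fun i j he =>
      Nat.eq_of_mul_eq_mul_left hKpos (by omega)
    have hc' := h.cyc_of_crossing hd hw (fun he => hij' (hinj _ _ he)) hc
    have := h.eq_of_cyc hd hw' hc' (f2 i)
    exact hij (by have := hinj _ _ this; omega)
  -- the order of three consecutive chords of the chain is transported along the orbit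
  have g1 : ∀ n, ArcMono (d ^ (K * n) • ·) {A 0, B 0, X 0, Y 0, A 1, B 1} := fun n => by
    refine (h.mono_right.iterate (s + K * (0 + 1)) (K * n)).mono ?_
    have c1 : Crossing (X 0) (Y 0) (A 0) (B 0) := Crossing.symm (Or.inr (f2 0))
    have c2 : Crossing (X 0) (Y 0) (A 1) (B 1) := Crossing.symm (Or.inl (f1 0))
    rintro p (rfl | rfl | rfl | rfl | rfl | rfl)
    exacts [c1.left_mem, c1.right_mem, left_mem_accordionEnds, right_mem_accordionEnds,
      c2.left_mem, c2.right_mem]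
  have g2 : ∀ n, ArcMono (d ^ (K * n) • ·) {X 0, Y 0, A 1, B 1, X 1, Y 1} := fun n => by
    refine (h.mono_left.iterate (s + K * 1) (K * n)).mono ?_
    have c1 : Crossing (A 1) (B 1) (X 0) (Y 0) := Or.inl (f1 0)
    have c2 : Crossing (A 1) (B 1) (X 1) (Y 1) := Or.inr (f2 1)
    rintro p (rfl | rfl | rfl | rfl | rfl | rfl)
    exacts [c1.left_mem, c1.right_mem, left_mem_accordionEnds, right_mem_accordionEnds,
      c2.left_mem, c2.right_mem]
  have eA : ∀ n i, d ^ (K * n) • A i = A (n + i) := fun n i => by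
    simp only [A, pow_smul_pow_smul]; congr 2; ring
  have eB : ∀ n i, d ^ (K * n) • B i = B (n + i) := fun n i => by
    simp only [B, pow_smul_pow_smul]; congr 2; ring
  have eX : ∀ n i, d ^ (K * n) • X i = X (n + i) := fun n i => by
    simp only [X, pow_smul_pow_smul]; congr 2; ring
  have eY : ∀ n i, d ^ (K * n) • Y i = Y (n + i) := fun n i => by
    simp only [Y, pow_smul_pow_smul]; congr 2; ring
  have hP : (∀ n, Cyc6 (A n) (Y n) (B n) (A (n + 1)) (X n) (B (n + 1))) ∨
      (∀ n, Cyc6 (B n) (X n) (A n) (B (n + 1)) (Y n) (A (n + 1))) := by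
    refine (cyc6_or_cyc6 (f2 0) (f1 0) (f3 0 1)).imp (fun hc n => ?_) fun hc n => ?_
    · have := (g1 n).cyc6 (by simp) (by simp) (by simp) (by simp) (by simp) (by simp) hc
      simpa only [eA, eB, eX, eY, add_zero] using this
    · have := (g1 n).cyc6 (by simp) (by simp) (by simp) (by simp) (by simp) (by simp) hc
      simpa only [eA, eB, eX, eY, add_zero] using this
  have hQ : (∀ n, Cyc6 (X n) (B (n + 1)) (Y n) (X (n + 1)) (A (n + 1)) (Y (n + 1))) ∨
      (∀ n, Cyc6 (Y n) (A (n + 1)) (X n) (Y (n + 1)) (B (n + 1)) (X (n + 1))) := by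
    refine (cyc6_or_cyc6 (f1 0).rotate (f2 1).rotate.rotate.rotate (f3' 0 1)).imp
      (fun hc n => ?_) fun hc n => ?_
    · have := (g2 n).cyc6 (by simp) (by simp) (by simp) (by simp) (by simp) (by simp) hc
      simpa only [eA, eB, eX, eY, add_zero] using this
    · have := (g2 n).cyc6 (by simp) (by simp) (by simp) (by simp) (by simp) (by simp) hc
      simpa only [eA, eB, eX, eY, add_zero] using this
  have hneg : ∀ {u : ℕ → UnitAddCircle}, (∀ i, u (i + 1) = d ^ K • u i) →
      ∀ i, -u (i + 1) = d ^ K • -u i := fun hu i => by rw [hu, smul_neg]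
  -- two of the four cases turn counterclockwise; the reflection of the circle reduces the other two
  -- to them
  rcases hP with hP | hP <;> rcases hQ with hQ | hQ
  · exact interleaved_chain_false (l := fun i => -B i) (r := fun i => -A i) (l' := fun i => -Y i)
      (r' := fun i => -X i) hD (hneg hB) (hneg hY) (fun i => (hP i).neg) (fun i => (hQ i).neg)
      (fun i j hc => f3 i j hc.of_neg.swap_left.swap_right)
      (fun i j hc => f3' i j hc.of_neg.swap_left.swap_right)
      (fun i j h1 h2 hc => f4 i j h1 h2 hc.of_neg.swap_left.swap_right)
  · exact interleaved_chain_false hD hA hY hP hQ f3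
      (fun i j hc => f3' i j hc.swap_left.swap_right)
      (fun i j h1 h2 hc => f4 i j h1 h2 hc.swap_right)
  · exact interleaved_chain_false hD hB hX hP hQ
      (fun i j hc => f3 i j hc.swap_left.swap_right) f3'
      (fun i j h1 h2 hc => f4 i j h1 h2 hc.swap_left)
  · exact interleaved_chain_false (l := fun i => -A i) (r := fun i => -B i) (l' := fun i => -X i)
      (r' := fun i => -Y i) hD (hneg hA) (hneg hX) (fun i => (hP i).neg) (fun i => (hQ i).neg)
      (fun i j hc => f3 i j hc.of_neg) (fun i j hc => f3' i j hc.of_neg)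
      (fun i j h1 h2 hc => f4 i j h1 h2 hc.of_neg)

/-- If neither chord is preperiodic, images of the two chords at different times do not cross. -/
lemma AccordionPair.not_crossing (hd : 2 ≤ d) (h : AccordionPair d a b x y)
    (hw : Wandering d a b) (hw' : Wandering d x y) {s t : ℕ} (hst : s ≠ t) :
    ¬ Crossing (d ^ s • a) (d ^ s • b) (d ^ t • x) (d ^ t • y) := by
  rcases hst.lt_or_gt with hlt | hlt
  · exact h.not_crossing_of_lt hd hw hw' hlt
  · exact fun hc => h.symm.not_crossing_of_lt hd hw' hw.symm hlt hc.symm.swap_right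

end Pair

/-! ### Endpoints of crossing chords -/

/-- If, read from some base point, no point of `E` lies strictly between points of `E'`, then `E`
does not separate `E'`. -/
lemma unseparated_of_base {E E' : Set UnitAddCircle} (c : UnitAddCircle)
    (h : ∀ p ∈ E, (∀ e ∈ E', arc c e ≤ arc c p) ∨ ∀ e ∈ E', arc c p ≤ arc c e) :
    Unseparated E E' := by
  intro p hp q hq r hr h0 hlt
  have hr0 := arc_nonneg c r
  have hq1 := arc_lt_one c q
  rcases le_or_gt (arc c p) (arc c q) with hpq | hpq
  · rw [arc_of_le hpq] at h0 hlt ⊢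
    rcases le_or_gt (arc c p) (arc c r) with hpr | hpr
    · rw [arc_of_le hpr] at hlt ⊢
      rcases h p hp with h1 | h1
      · refine Or.inr (Or.inr fun e he => ?_)
        rcases (h1 e he).eq_or_lt with h2 | h2
        · exact Or.inl (arc_left_inj.1 h2)
        · rw [arc_of_lt h2]; right; linarith [arc_lt_one c r, arc_nonneg c e]
      · rcases h q hq with h2 | h2
        · refine Or.inl fun e he => ?_
          rw [arc_of_le (h1 e he)]; linarith [h2 e he]
        · rcases h r hr with h3 | h3
          · refine Or.inr (Or.inl fun e he => ?_)
            rw [arc_of_le (h1 e he)]; constructor <;> linarith [h2 e he, h3 e he]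
          · refine Or.inr (Or.inr fun e he => Or.inr ?_)
            rw [arc_of_le (h1 e he)]; linarith [h3 e he]
    · rw [arc_of_lt hpr] at hlt ⊢
      rcases h q hq with h2 | h2
      · rcases h p hp with h1 | h1
        · rcases h r hr with h3 | h3
          · refine Or.inr (Or.inl fun e he => ?_)
            have := h3 e he
            rw [arc_of_lt (show arc c e < arc c p by linarith)]
            constructor <;> linarith [arc_nonneg c e]
          · refine Or.inr (Or.inr fun e he => ?_)
            rcases (h1 e he).eq_or_lt with h4 | h4
            · exact Or.inl (arc_left_inj.1 h4)
            · rw [arc_of_lt h4]; right; linarith [h3 e he]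
        · refine Or.inl fun e he => ?_
          rw [arc_of_le (h1 e he)]; linarith [h2 e he]
      · refine Or.inr (Or.inl fun e he => ?_)
        have := h2 e he
        rw [arc_of_le (show arc c p ≤ arc c e by linarith)]
        constructor <;> linarith [arc_lt_one c e]
  · rw [arc_of_lt hpq] at h0 hlt ⊢
    have hpr : arc c r < arc c p := by
      by_contra! hc
      rw [arc_of_le hc] at hlt
      linarith [arc_nonneg c q, arc_lt_one c r]
    rw [arc_of_lt hpr] at hlt ⊢
    rcases h p hp with h1 | h1
    · rcases h q hq with h2 | h2
      · refine Or.inl fun e he => ?_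
        have := h2 e he
        rw [arc_of_lt (show arc c e < arc c p by linarith)]; linarith
      · rcases h r hr with h3 | h3
        · refine Or.inr (Or.inl fun e he => ?_)
          have := h3 e he
          rw [arc_of_lt (show arc c e < arc c p by linarith)]; constructor <;> linarith [h2 e he]
        · refine Or.inr (Or.inr fun e he => ?_)
          rcases (h1 e he).eq_or_lt with h4 | h4
          · exact Or.inl (arc_left_inj.1 h4)
          · rw [arc_of_lt h4]; right; linarith [h3 e he]
    · refine Or.inl fun e he => ?_
      rw [arc_of_le (h1 e he)]; linarith [arc_lt_one c e, arc_nonneg c q]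

/-- Crossing of chords in terms of coordinates read from a base point. -/
lemma crossing_iff_coord {o a b x y : UnitAddCircle} (hab : arc o a < arc o b) :
    Crossing a b x y ↔
      (arc o a < arc o x ∧ arc o x < arc o b ∧ (arc o y < arc o a ∨ arc o b < arc o y)) ∨
      (arc o a < arc o y ∧ arc o y < arc o b ∧ (arc o x < arc o a ∨ arc o b < arc o x)) := by
  have aux : ∀ x y, Cyc4 a x b y ↔
      (arc o a < arc o x ∧ arc o x < arc o b ∧ (arc o y < arc o a ∨ arc o b < arc o y)) := by
    intro x y
    have h1 := arc_nonneg o x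
    have h3 := arc_nonneg o y
    have h4 := arc_lt_one o y
    have h5 := arc_nonneg o a
    have h6 := arc_lt_one o b
    rw [Cyc4, arc_of_le hab.le]
    rcases le_or_gt (arc o a) (arc o x) with hx | hx <;>
      rcases le_or_gt (arc o a) (arc o y) with hy | hy
    · rw [arc_of_le hx, arc_of_le hy]
      constructor
      · rintro ⟨g1, g2, g3⟩; exact ⟨by linarith, by linarith, Or.inr (by linarith)⟩
      · rintro ⟨g1, g2, g3 | g3⟩
        · linarith
        · exact ⟨by linarith, by linarith, by linarith⟩
    · rw [arc_of_le hx, arc_of_lt hy]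
      constructor
      · rintro ⟨g1, g2, g3⟩; exact ⟨by linarith, by linarith, Or.inl hy⟩
      · rintro ⟨g1, g2, -⟩
        exact ⟨by linarith, by linarith, by linarith⟩
    all_goals
      rw [arc_of_lt hx]
      constructor
      · rintro ⟨g1, g2, g3⟩; linarith
      · rintro ⟨g1, g2, g3⟩; linarith
  exact or_congr (aux x y) (aux y x)

/-- The endpoints of the chord `a b` and of the chords in `G`. -/
def chordEnds (a b : UnitAddCircle) (G : Set (UnitAddCircle × UnitAddCircle)) :
    Set UnitAddCircle :=
  {p | p = a ∨ p = b ∨ ∃ z ∈ G, p = z.1 ∨ p = z.2}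

/-- The case of `unseparated_chordEnds` in which `a', b'` follow each other on the positive side of
`a b`. Then all of the second family lies there, and read from `a` it lies between neighbouring
endpoints of the first family. -/
lemma unseparated_chordEnds_of_le {a b a' b' : UnitAddCircle}
    {G G' : Set (UnitAddCircle × UnitAddCircle)} (hab : a ≠ b)
    (hG : ∀ z ∈ G, Cyc4 a z.1 b z.2) (hG' : ∀ z ∈ G', Crossing a' b' z.1 z.2)
    (hlt : arc a a' < arc a b') (hle : arc a b' ≤ arc a b)
    (h2 : ∀ z ∈ G', ¬ Crossing a b z.1 z.2) (h3 : ∀ z ∈ G, ¬ Crossing a' b' z.1 z.2)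
    (h4 : ∀ z ∈ G, ∀ w ∈ G', ¬ Crossing z.1 z.2 w.1 w.2) :
    Unseparated (chordEnds a b G) (chordEnds a' b' G') := by
  have hab' : arc a a < arc a b := by rw [arc_self]; exact arc_pos_iff.2 hab.symm
  have ha' := arc_nonneg a a'
  have hall : ∀ e ∈ chordEnds a' b' G', arc a e ≤ arc a b := by
    rintro e (rfl | rfl | ⟨w, hw, hew⟩)
    · linarith
    · exact hle
    · have g1 := h2 w hw
      have g2 := hG' w hw
      rw [crossing_iff_coord hab', arc_self] at g1
      rw [crossing_iff_coord hlt] at g2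
      by_contra! hc
      rcases hew with rfl | rfl <;> rcases g2 with ⟨g2, g3, -⟩ | ⟨g2, g3, -⟩ <;> first
        | linarith
        | exact g1 (Or.inl ⟨by linarith, by linarith, Or.inr hc⟩)
        | exact g1 (Or.inr ⟨by linarith, by linarith, Or.inr hc⟩)
  refine unseparated_of_base a ?_
  rintro p (rfl | rfl | ⟨z, hz, hp⟩)
  · exact Or.inr fun e _ => by rw [arc_self]; exact arc_nonneg _ _
  · exact Or.inl hall
  obtain ⟨z1, z2, z3⟩ := hG z hz
  rcases hp with rfl | rfl
  · have g := h3 z hz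
    rw [crossing_iff_coord hlt] at g
    have hz' : arc a z.1 < arc a z.2 := by linarith
    rcases le_or_gt (arc a b') (arc a z.1) with hc | hc
    · left
      rintro e he
      have heb := hall e he
      rcases he with rfl | rfl | ⟨w, hw, hew⟩
      · linarith
      · exact hc
      · have g1 := h4 z hz w hw
        have g2 := hG' w hw
        rw [crossing_iff_coord hz'] at g1
        rw [crossing_iff_coord hlt] at g2
        by_contra! hc'
        rcases hew with rfl | rfl <;> rcases g2 with ⟨g2, g3, -⟩ | ⟨g2, g3, -⟩ <;> first
          | linarith
          | exact g1 (Or.inl ⟨by linarith, by linarith, Or.inl (by linarith)⟩)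
          | exact g1 (Or.inr ⟨by linarith, by linarith, Or.inl (by linarith)⟩)
    · have hc2 : arc a z.1 ≤ arc a a' := by
        by_contra! hc2
        exact g (Or.inl ⟨hc2, hc, Or.inr (by linarith)⟩)
      right
      rintro e he
      have heb := hall e he
      rcases he with rfl | rfl | ⟨w, hw, hew⟩
      · exact hc2
      · linarith
      · have g1 := h4 z hz w hw
        have g2 := hG' w hw
        rw [crossing_iff_coord hz'] at g1
        rw [crossing_iff_coord hlt] at g2
        by_contra! hc'
        rcases hew with rfl | rfl <;> rcases g2 with ⟨g2, g3, -⟩ | ⟨g2, g3, -⟩ <;> first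
          | linarith
          | exact g1 (Or.inl ⟨by linarith, by linarith, Or.inl (by linarith)⟩)
          | exact g1 (Or.inr ⟨by linarith, by linarith, Or.inl (by linarith)⟩)
  · exact Or.inl fun e he => (hall e he).trans z3.le

lemma unseparated_chordEnds_of_le' {a b a' b' : UnitAddCircle}
    {G G' : Set (UnitAddCircle × UnitAddCircle)} (hab : a ≠ b) (hab' : a' ≠ b')
    (hG : ∀ z ∈ G, Cyc4 a z.1 b z.2) (hG' : ∀ z ∈ G', Crossing a' b' z.1 z.2)
    (hle' : arc a a' ≤ arc a b) (hle : arc a b' ≤ arc a b)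
    (h2 : ∀ z ∈ G', ¬ Crossing a b z.1 z.2) (h3 : ∀ z ∈ G, ¬ Crossing a' b' z.1 z.2)
    (h4 : ∀ z ∈ G, ∀ w ∈ G', ¬ Crossing z.1 z.2 w.1 w.2) :
    Unseparated (chordEnds a b G) (chordEnds a' b' G') := by
  rcases lt_trichotomy (arc a a') (arc a b') with h | h | h
  · exact unseparated_chordEnds_of_le hab hG hG' h hle h2 h3 h4
  · exact absurd (arc_left_inj.1 h) hab'
  · have := unseparated_chordEnds_of_le hab hG (fun z hz => (hG' z hz).swap_left) h hle' h2
      (fun z hz hc => h3 z hz hc.swap_left) h4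
    have e : chordEnds b' a' G' = chordEnds a' b' G' := by
      ext p; exact or_left_comm
    rwa [e] at this

/-- Two chords `a b`, `a' b'` together with chords crossing them: if no chord of the first family
crosses a chord of the second one, the endpoints of the first family do not separate those of the
second one. -/
lemma unseparated_chordEnds {a b a' b' : UnitAddCircle}
    {G G' : Set (UnitAddCircle × UnitAddCircle)} (hab : a ≠ b) (hab' : a' ≠ b')
    (hG : ∀ z ∈ G, Cyc4 a z.1 b z.2) (hG' : ∀ z ∈ G', Crossing a' b' z.1 z.2)
    (h1 : ¬ Crossing a b a' b')
    (h2 : ∀ z ∈ G', ¬ Crossing a b z.1 z.2) (h3 : ∀ z ∈ G, ¬ Crossing a' b' z.1 z.2)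
    (h4 : ∀ z ∈ G, ∀ w ∈ G', ¬ Crossing z.1 z.2 w.1 w.2) :
    Unseparated (chordEnds a b G) (chordEnds a' b' G') := by
  by_cases hside : arc a a' ≤ arc a b ∧ arc a b' ≤ arc a b
  · exact unseparated_chordEnds_of_le' hab hab' hG hG' hside.1 hside.2 h2 h3 h4
  -- otherwise `a'` and `b'` lie on the other side of `a b`; exchange the roles of `a` and `b`
  have hpos : arc a a < arc a b := by rw [arc_self]; exact arc_pos_iff.2 hab.symm
  have hb := arc_lt_one a b
  rw [crossing_iff_coord hpos, arc_self] at h1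
  have hside' : ∀ p q, arc a b < arc a p → (¬ (0 < arc a q ∧ arc a q < arc a b)) →
      arc b p ≤ arc b a ∧ arc b q ≤ arc b a := by
    intro p q hp hq
    have e : arc b a = 1 - arc a b := arc_swap hab.symm
    rw [e, arc_of_le hp.le]
    refine ⟨by linarith [arc_lt_one a p], ?_⟩
    rcases (arc_nonneg a q).eq_or_lt with hq0 | hq0
    · rw [← arc_left_inj.1 (hq0 ▸ arc_self a : arc a a = arc a q), e]
    · have : arc a b ≤ arc a q := by
        by_contra! hc
        exact hq ⟨hq0, hc⟩
      rw [arc_of_le this]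
      linarith [arc_lt_one a q]
  have hs : arc b a' ≤ arc b a ∧ arc b b' ≤ arc b a := by
    by_cases hc : arc a b < arc a a'
    · exact hside' a' b' hc fun hq => h1 (Or.inr ⟨hq.1, hq.2, Or.inr hc⟩)
    · have hc' : arc a b < arc a b' := by
        by_contra! hc'
        exact hside ⟨not_lt.1 hc, hc'⟩
      exact (hside' b' a' hc' fun hq => h1 (Or.inl ⟨hq.1, hq.2, Or.inr hc'⟩)).symm
  have := unseparated_chordEnds_of_le' (G := Prod.swap ⁻¹' G) (G' := G') hab.symm hab'
    (fun z hz => (hG z.swap hz).rotate.rotate) hG' hs.1 hs.2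
    (fun z hz hc => h2 z hz hc.swap_left) (fun z hz hc => h3 z.swap hz hc.swap_right)
    (fun z hz w hw hc => h4 z.swap hz w hw hc.swap_left)
  have e : chordEnds b a (Prod.swap ⁻¹' G) = chordEnds a b G := by
    ext p
    constructor
    · rintro (h | h | ⟨z, hz, h⟩)
      exacts [Or.inr (Or.inl h), Or.inl h, Or.inr (Or.inr ⟨z.swap, hz, h.symm⟩)]
    · rintro (h | h | ⟨z, hz, h⟩)
      exacts [Or.inr (Or.inl h), Or.inl h, Or.inr (Or.inr ⟨z.swap, by simpa using hz, h.symm⟩)]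
  rwa [e] at this

/-- If `a b` has a finite orbit, then so has `x y`: an iterate fixing an image of `a b` moves the
endpoints of the corresponding image of `x y` monotonically, hence eventually fixes them. -/
lemma AccordionPair.not_wandering {d : ℕ} (hd : 2 ≤ d) {a b x y : UnitAddCircle}
    (h : AccordionPair d a b x y) (hw : ¬ Wandering d a b) : ¬ Wandering d x y := by
  rw [Wandering] at hw
  push Not at hw
  obtain ⟨i, k, hk, ha, hb⟩ := hw
  have hper : ∀ p : UnitAddCircle, d ^ (i + k) • p = d ^ i • p →
      ∀ j, d ^ (i + k * j) • p = d ^ i • p := by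
    intro p hp j
    induction j with
    | zero => simp
    | succ j ih =>
      have : i + k * (j + 1) = i + k * j + k := by ring
      rw [this, ← pow_smul_pow_smul, ih, pow_smul_pow_smul, hp]
  have hcross : ∀ j, Crossing (d ^ i • a) (d ^ i • b) (d ^ (i + k * j) • x)
      (d ^ (i + k * j) • y) := by
    intro j
    have := h.cyc_iterate (i + k * j)
    rw [hper a ha, hper b hb] at this
    exact Or.inl this
  have key : ∀ p : UnitAddCircle, (∀ j, d ^ (i + k * j) • p ∈
      accordionEnds d (d ^ i • a) (d ^ i • b) x y) →
      ∃ N, ∀ j, N ≤ j → d ^ (i + k * (j + 1)) • p = d ^ (i + k * j) • p := by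
    intro p hp
    have e : ∀ j m, d ^ (k * j) • d ^ (i + k * m) • p = d ^ (i + k * (m + j)) • p := by
      intro j m; rw [pow_smul_pow_smul]; congr 2; ring
    have e' : ∀ j, d ^ (k * j) • d ^ i • a = d ^ i • a := fun j => by
      rw [pow_smul_pow_smul, hper a ha]
    have horbit : ∀ j, ((((d ^ k : ℕ) : ℝ) * arc (d ^ i • a) (d ^ (i + k * j) • p) : ℝ) :
        UnitAddCircle) = (arc (d ^ i • a) (d ^ (i + k * (j + 1)) • p) : ℝ) := by
      intro j
      have e1 := e 1 j
      have e1' := e' 1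
      rw [mul_one] at e1 e1'
      rw [← nsmul_eq_mul, AddCircle.coe_nsmul, coe_arc, coe_arc, smul_sub, e1, e1']
    have hmono : ∀ j m n, arc (d ^ i • a) (d ^ (i + k * m) • p) ≤
        arc (d ^ i • a) (d ^ (i + k * n) • p) → arc (d ^ i • a) (d ^ (i + k * (m + j)) • p) ≤
        arc (d ^ i • a) (d ^ (i + k * (n + j)) • p) := by
      intro j m n hmn
      have := ((h.mono_left.iterate i (k * j)).le_iff left_mem_accordionEnds (hp m) (hp n)).1 hmn
      simpa only [e, e'] using this
    have hfix : ∀ {N : ℕ}, (∀ j, N ≤ j → arc (d ^ i • a) (d ^ (i + k * (j + 1)) • p) =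
        arc (d ^ i • a) (d ^ (i + k * j) • p)) →
        ∃ N, ∀ j, N ≤ j → d ^ (i + k * (j + 1)) • p = d ^ (i + k * j) • p :=
      fun {N} hN => ⟨N, fun j hj => arc_left_inj.1 (hN j hj)⟩
    rcases le_total (arc (d ^ i • a) (d ^ (i + k * 0) • p))
      (arc (d ^ i • a) (d ^ (i + k * 1) • p)) with hle | hle
    · obtain ⟨N, hN⟩ := eventually_const_of_monotone (two_le_pow hd hk)
        (z := fun j => arc (d ^ i • a) (d ^ (i + k * j) • p))
        (monotone_nat_of_le_succ fun j => by
          have := hmono j 0 1 hle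
          rwa [Nat.zero_add, Nat.add_comm 1 j] at this)
        (fun j => (arc_lt_one _ _).le) horbit
      exact hfix hN
    · obtain ⟨N, hN⟩ := eventually_const_of_antitone (two_le_pow hd hk)
        (z := fun j => arc (d ^ i • a) (d ^ (i + k * j) • p))
        (antitone_nat_of_succ_le fun j => by
          have := hmono j 1 0 hle
          rwa [Nat.zero_add, Nat.add_comm 1 j] at this)
        (fun j => arc_nonneg _ _) horbit
      exact hfix hN
  obtain ⟨M, hM⟩ := key x fun j => (hcross j).left_mem
  obtain ⟨N, hN⟩ := key y fun j => (hcross j).right_mem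
  have e : i + k * max M N + k = i + k * (max M N + 1) := by ring
  intro hw
  refine hw (i + k * max M N) k hk ?_
  rw [e]
  exact ⟨hM _ (le_max_left M N), hN _ (le_max_right M N)⟩

/-! ### Leaves of invariant geolaminations -/

lemma iterate_chordMap (d n : ℕ) (a b : UnitAddCircle) :
    (chordMap d)^[n] s(a, b) = s(d ^ n • a, d ^ n • b) := by
  induction n with
  | zero => simp
  | succ n ih =>
    rw [Function.iterate_succ_apply', ih, chordMap, Sym2.map_mk, sigma, sigma, smul_smul, smul_smul,
      ← pow_succ']

lemma isPreperiodicChord_iff {d : ℕ} {a b : UnitAddCircle} :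
    IsPreperiodicChord d s(a, b) ↔ ¬ Wandering d a b := by
  constructor
  · rintro ⟨m, n, hn, hper⟩ hw
    rw [Function.IsPeriodicPt, Function.IsFixedPt, ← Function.iterate_add_apply, iterate_chordMap,
      iterate_chordMap, Sym2.eq_iff, add_comm n m] at hper
    rcases hper with h | ⟨h1, h2⟩
    · exact hw m n hn h
    -- if the endpoints are exchanged after `n` steps, they return after `2 * n` steps
    · refine hw m (n + n) (by omega) ⟨?_, ?_⟩
      · rw [← add_assoc, ← pow_smul_pow_smul, h1, pow_smul_pow_smul, h2]
      · rw [← add_assoc, ← pow_smul_pow_smul, h2, pow_smul_pow_smul, h1]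
  · intro hw
    rw [Wandering] at hw
    push Not at hw
    obtain ⟨i, k, hk, ha, hb⟩ := hw
    refine ⟨i, k, hk, ?_⟩
    rw [Function.IsPeriodicPt, Function.IsFixedPt, ← Function.iterate_add_apply, iterate_chordMap,
      iterate_chordMap, add_comm k i, ha, hb]

lemma IsInvariantGeolamination.iterate_mem {d : ℕ} {L : Set Chord}
    (hL : IsInvariantGeolamination d L) {l : Chord} (hl : l ∈ L) (n : ℕ) :
    (chordMap d)^[n] l ∈ L := by
  induction n with
  | zero => exact hl
  | succ n ih => rw [Function.iterate_succ_apply']; exact hL.map_mem _ ih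

lemma IsGeolamination.not_crossing {L : Set Chord} (hL : IsGeolamination L)
    {a b x y : UnitAddCircle} (h : s(a, b) ∈ L) (h' : s(x, y) ∈ L) : ¬ Crossing a b x y := by
  intro hc
  obtain ⟨hne, z, ⟨hz1, hz2⟩, hz3⟩ := hc.linked
  exact Set.disjoint_left.1 (hL.pairwise_disjoint _ h _ h' hne) ⟨hz1, hz3⟩ ⟨hz2, hz3⟩

lemma IsInvariantGeolamination.not_crossing {d : ℕ} {L : Set Chord}
    (hL : IsInvariantGeolamination d L) {a b x y : UnitAddCircle} (h : s(a, b) ∈ L)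
    (h' : s(x, y) ∈ L) (i j : ℕ) :
    ¬ Crossing (d ^ i • a) (d ^ i • b) (d ^ j • x) (d ^ j • y) := by
  refine hL.toIsGeolamination.not_crossing ?_ ?_
  · rw [← iterate_chordMap]; exact hL.iterate_mem h i
  · rw [← iterate_chordMap]; exact hL.iterate_mem h' j

lemma HasOrderPreservingAccordions.monoAccordions {d : ℕ} {a b x y : UnitAddCircle}
    (h : HasOrderPreservingAccordions d s(a, b) s(x, y)) : MonoAccordions d a b x y := by
  intro s
  refine (h.2 s).arcMono.mono ?_
  rw [iterate_chordMap]
  rintro p (rfl | rfl | ⟨t, hc, hp⟩)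
  · exact ⟨_, Or.inl rfl, Sym2.mem_mk_left _ _⟩
  · exact ⟨_, Or.inl rfl, Sym2.mem_mk_right _ _⟩
  · exact ⟨s(d ^ t • x, d ^ t • y), Or.inr ⟨⟨t, (iterate_chordMap d t x y).symm⟩, hc.symm.linked⟩,
      Sym2.mem_iff.2 hp⟩

/-- A leaf that is linked with `a b` and has mutually order preserving accordions with it can be
written as `x y` with `a, x, b, y` in positive circular order. -/
lemma exists_accordionPair {d : ℕ} {L₁ L₂ : Set Chord} (hL₁ : IsInvariantGeolamination d L₁)
    (hL₂ : IsInvariantGeolamination d L₂) {a b : UnitAddCircle} (hl : IsLeaf L₁ s(a, b))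
    {l : Chord} (h : l ∈ linkedMutualLeaves d L₂ s(a, b)) :
    ∃ x y, l = s(x, y) ∧ s(x, y) ∈ L₂ ∧ AccordionPair d a b x y := by
  induction l using Sym2.ind with
  | _ x y =>
  obtain ⟨⟨hmem, hdiag⟩, hlink, hacc, hacc'⟩ := h
  have hab : a ≠ b := hl.2
  have hc : Crossing a b x y := (hlink.crossing hdiag hab).symm
  have mk : ∀ x y : UnitAddCircle, Cyc4 a x b y → s(x, y) ∈ L₂ →
      HasOrderPreservingAccordions d s(a, b) s(x, y) →
      HasOrderPreservingAccordions d s(x, y) s(a, b) → AccordionPair d a b x y :=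
    fun x y h1 h2 h3 h4 => ⟨h1, hL₁.not_crossing hl.1 hl.1, hL₂.not_crossing h2 h2,
      h3.monoAccordions, h4.monoAccordions⟩
  rcases hc with hc | hc
  · exact ⟨x, y, rfl, hmem, mk x y hc hmem hacc hacc'⟩
  · have hswap : s(x, y) = s(y, x) := Sym2.eq_swap
    rw [hswap] at hmem hacc hacc'
    exact ⟨y, x, hswap, hmem, mk y x hc hmem hacc hacc'⟩

lemma countable_setOf_not_wandering {d : ℕ} (hd : 2 ≤ d) :
    {z : UnitAddCircle × UnitAddCircle | ¬ Wandering d z.1 z.2}.Countable := by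
  have hfin : ∀ i k : ℕ, 0 < k →
      {p : UnitAddCircle | d ^ (i + k) • p = d ^ i • p}.Finite := by
    intro i k hk
    have hlt : d ^ i < d ^ (i + k) := Nat.pow_lt_pow_right (by omega) (by omega)
    refine (AddCircle.finite_torsion (1 : ℝ) (n := d ^ (i + k) - d ^ i) (by omega)).subset ?_
    intro p hp
    have hp' : d ^ (i + k) • p = d ^ i • p := hp
    have e : (d ^ (i + k) - d ^ i) • p + d ^ i • p = d ^ (i + k) • p := by
      rw [← add_smul, Nat.sub_add_cancel hlt.le]
    rw [hp'] at e
    exact add_eq_right.1 e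
  refine (Set.countable_iUnion fun i : ℕ => Set.countable_iUnion fun k : ℕ =>
    Set.countable_iUnion fun hk : 0 < k =>
      ((hfin i k hk).prod (hfin i k hk)).countable).mono ?_
  intro z hz
  have hz' : ¬ Wandering d z.1 z.2 := hz
  rw [Wandering] at hz'
  push Not at hz'
  obtain ⟨i, k, hk, h1, h2⟩ := hz'
  simp only [Set.mem_iUnion]
  exact ⟨i, k, hk, h1, h2⟩

/-- For a wandering chord `a b`, only finitely many chords with pairwise unlinked images can form
accordion pairs with it: the endpoints at different times do not separate each other. -/
lemma finite_of_accordionPair {d : ℕ} (hd : 2 ≤ d) {a b : UnitAddCircle} (hw : Wandering d a b)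
    {G : Set (UnitAddCircle × UnitAddCircle)} (hG : ∀ z ∈ G, AccordionPair d a b z.1 z.2)
    (hun : ∀ z ∈ G, ∀ w ∈ G, ∀ i j : ℕ,
      ¬ Crossing (d ^ i • z.1) (d ^ i • z.2) (d ^ j • w.1) (d ^ j • w.2)) : G.Finite := by
  rcases G.eq_empty_or_nonempty with rfl | ⟨z₀, hz₀⟩
  · exact Set.finite_empty
  have hw' : ∀ z ∈ G, Wandering d z.1 z.2 := by
    intro z hz
    by_contra hc
    exact (hG z hz).symm.not_wandering hd hc hw.symm
  let Gt : ℕ → Set (UnitAddCircle × UnitAddCircle) := fun t =>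
    (fun z => (d ^ t • z.1, d ^ t • z.2)) '' G
  let E : ℕ → Set UnitAddCircle := fun t => chordEnds (d ^ t • a) (d ^ t • b) (Gt t)
  have hne : ∀ t : ℕ, d ^ t • a ≠ d ^ t • b := fun t => ((hG z₀ hz₀).cyc_iterate t).ne
  have hstep : ∀ t, E (t + 1) = (d • ·) '' E t := by
    intro t
    have e : ∀ p : UnitAddCircle, d ^ (t + 1) • p = d • d ^ t • p := fun p => by
      rw [smul_smul, pow_succ']
    ext p
    constructor
    · rintro (h | h | ⟨_, ⟨z, hz, rfl⟩, h | h⟩)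
      · exact ⟨_, Or.inl rfl, by rw [h, e]⟩
      · exact ⟨_, Or.inr (Or.inl rfl), by rw [h, e]⟩
      · exact ⟨_, Or.inr (Or.inr ⟨_, ⟨z, hz, rfl⟩, Or.inl rfl⟩), by simp only [h, e]⟩
      · exact ⟨_, Or.inr (Or.inr ⟨_, ⟨z, hz, rfl⟩, Or.inr rfl⟩), by simp only [h, e]⟩
    · rintro ⟨_, h | h | ⟨_, ⟨z, hz, rfl⟩, h | h⟩, rfl⟩
      · exact Or.inl (by simp only [h, e])
      · exact Or.inr (Or.inl (by simp only [h, e]))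
      · exact Or.inr (Or.inr ⟨_, ⟨z, hz, rfl⟩, Or.inl (by simp only [h, e])⟩)
      · exact Or.inr (Or.inr ⟨_, ⟨z, hz, rfl⟩, Or.inr (by simp only [h, e])⟩)
  have hE : (E 0).Finite := by
    refine finite_of_unseparated hd hstep fun s t hst => ?_
    refine unseparated_chordEnds (hne s) (hne t) ?_ ?_ ((hG z₀ hz₀).unlinked_left s t) ?_ ?_ ?_
    · rintro _ ⟨z, hz, rfl⟩; exact (hG z hz).cyc_iterate s
    · rintro _ ⟨z, hz, rfl⟩; exact Or.inl ((hG z hz).cyc_iterate t)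
    · rintro _ ⟨z, hz, rfl⟩; exact (hG z hz).not_crossing hd hw (hw' z hz) hst
    · rintro _ ⟨z, hz, rfl⟩; exact (hG z hz).not_crossing hd hw (hw' z hz) hst.symm
    · rintro _ ⟨z, hz, rfl⟩ _ ⟨w, hw, rfl⟩; exact hun z hz w hw s t
  refine (hE.prod hE).subset fun z hz => ?_
  have hz' : z ∈ Gt 0 := ⟨z, hz, by simp⟩
  exact ⟨Or.inr (Or.inr ⟨z, hz', Or.inl rfl⟩), Or.inr (Or.inr ⟨z, hz', Or.inr rfl⟩)⟩

end Geolam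

theorem corollary3 (d : ℕ) (hd : 2 ≤ d) (L₁ L₂ : Set Geolam.Chord)
    (hL₁ : Geolam.IsInvariantGeolamination d L₁) (hL₂ : Geolam.IsInvariantGeolamination d L₂)
    (l₁ : Geolam.Chord) (hl₁ : Geolam.IsLeaf L₁ l₁) :
    (¬ Geolam.IsPreperiodicChord d l₁ → (Geolam.linkedMutualLeaves d L₂ l₁).Finite) ∧
    (Geolam.IsPreperiodicChord d l₁ → (Geolam.linkedMutualLeaves d L₂ l₁).Countable) := by
  induction l₁ using Sym2.ind with
  | _ a b =>
  let G : Set (UnitAddCircle × UnitAddCircle) :=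
    {z | s(z.1, z.2) ∈ L₂ ∧ Geolam.AccordionPair d a b z.1 z.2}
  have hsub : Geolam.linkedMutualLeaves d L₂ s(a, b) ⊆ (fun z => s(z.1, z.2)) '' G := by
    intro l hl
    obtain ⟨x, y, rfl, h1, h2⟩ := Geolam.exists_accordionPair hL₁ hL₂ hl₁ hl
    exact ⟨(x, y), ⟨h1, h2⟩, rfl⟩
  rw [Geolam.isPreperiodicChord_iff, not_not]
  refine ⟨fun hw => ?_, fun hw => ?_⟩
  · exact ((Geolam.finite_of_accordionPair hd hw (fun z hz => hz.2)
      fun z hz w hw => hL₂.not_crossing hz.1 hw.1).image _).subset hsub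
  · refine ((Geolam.countable_setOf_not_wandering hd).mono ?_).image _ |>.mono hsub
    exact fun z hz => hz.2.not_wandering hd hw
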